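/- Let $(M,g)$ be a compact connected smooth Riemannian manifold without boundary, of dimension $n$, let $f\in C^\infty(M)$ and let $\gamma>0$ be a constant such that $$R_{ij}-\gamma g_{ij}+\nabla_i\nabla_j f=0,$$ where $R_{ij}$ is the Ricci curvature of $g$ (that is, $g$ is a gradient shrinking Ricci soliton with potential $f$). Assume that $f$ is normalized by $$\int_M f e^{-f}\,dV_g=0.$$ Let $\Delta_f u=\Delta u-\nabla f\cdot\nabla u$, with $\Delta=g^{ij}\nabla_i\nabla_j$, be the Bakry–Émery Laplacian. Then $$\Delta_f f=-2\gamma f\quad\text{on } M.$$ Moreover, if the soliton is nontrivial, i.e. $\nabla f\not\equiv 0$, then $f\not\equiv 0$, so that $f$ is an eigenfunction of $\Delta_f$ with eigenvalue $-2\gamma$. -/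

import Mathlib

open scoped Manifold ContDiff Bundle

noncomputable section

namespace Riem

/-! ### Coordinate formulas

`G : ℝⁿ → Matrix` is the matrix `(g_ij)` of a Riemannian metric in the coordinates
`y = (y^1, …, y^n)`; functions are written in the same coordinates. -/

/-- The partial derivative `∂h/∂y^i`. -/
def pderiv {n : ℕ} (i : Fin n) (h : EuclideanSpace ℝ (Fin n) → ℝ)
    (y : EuclideanSpace ℝ (Fin n)) : ℝ :=
  fderiv ℝ h y (EuclideanSpace.single i 1)

/-- The Christoffel symbol `Γ^k_ij = ½ g^{kl} (∂_i g_jl + ∂_j g_il - ∂_l g_ij)` of the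
Levi-Civita connection. -/
def christoffel {n : ℕ} (G : EuclideanSpace ℝ (Fin n) → Matrix (Fin n) (Fin n) ℝ)
    (k i j : Fin n) (y : EuclideanSpace ℝ (Fin n)) : ℝ :=
  (1 / 2 : ℝ) * ∑ l, (G y)⁻¹ k l *
    (pderiv i (fun z => G z j l) y + pderiv j (fun z => G z i l) y
      - pderiv l (fun z => G z i j) y)

/-- The component `R^l_ijk` of the curvature tensor, where `R(∂_i, ∂_j) ∂_k = R^l_ijk ∂_l` and
`R(X, Y) Z = ∇_X ∇_Y Z - ∇_Y ∇_X Z - ∇_[X,Y] Z`. -/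
def curvature {n : ℕ} (G : EuclideanSpace ℝ (Fin n) → Matrix (Fin n) (Fin n) ℝ)
    (l i j k : Fin n) (y : EuclideanSpace ℝ (Fin n)) : ℝ :=
  pderiv i (christoffel G l j k) y - pderiv j (christoffel G l i k) y
    + ∑ m, (christoffel G m j k y * christoffel G l i m y
      - christoffel G m i k y * christoffel G l j m y)

/-- The component `R_jk = R^i_ijk` of the Ricci tensor (it equals `(n - 1) g_jk` for the
unit sphere). -/
def ricci {n : ℕ} (G : EuclideanSpace ℝ (Fin n) → Matrix (Fin n) (Fin n) ℝ)
    (j k : Fin n) (y : EuclideanSpace ℝ (Fin n)) : ℝ :=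
  ∑ i, curvature G i i j k y

/-- The component `∇_i ∇_j u = ∂_i ∂_j u - Γ^k_ij ∂_k u` of the Hessian of `u`. -/
def hessian {n : ℕ} (G : EuclideanSpace ℝ (Fin n) → Matrix (Fin n) (Fin n) ℝ)
    (u : EuclideanSpace ℝ (Fin n) → ℝ) (i j : Fin n) (y : EuclideanSpace ℝ (Fin n)) : ℝ :=
  pderiv i (pderiv j u) y - ∑ k, christoffel G k i j y * pderiv k u y

/-- The Laplacian `Δ u = g^{ij} ∇_i ∇_j u`. -/
def laplacian {n : ℕ} (G : EuclideanSpace ℝ (Fin n) → Matrix (Fin n) (Fin n) ℝ)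
    (u : EuclideanSpace ℝ (Fin n) → ℝ) (y : EuclideanSpace ℝ (Fin n)) : ℝ :=
  ∑ i, ∑ j, (G y)⁻¹ i j * hessian G u i j y

/-- The inner product of gradients, `∇φ · ∇u = g^{ij} ∂_i φ ∂_j u`. -/
def gradInner {n : ℕ} (G : EuclideanSpace ℝ (Fin n) → Matrix (Fin n) (Fin n) ℝ)
    (φ u : EuclideanSpace ℝ (Fin n) → ℝ) (y : EuclideanSpace ℝ (Fin n)) : ℝ :=
  ∑ i, ∑ j, (G y)⁻¹ i j * pderiv i φ y * pderiv j u y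

/-- The Bakry-Émery Laplacian `Δ_φ u = Δ u - ∇φ · ∇u`. -/
def bakryEmeryLaplacian {n : ℕ} (G : EuclideanSpace ℝ (Fin n) → Matrix (Fin n) (Fin n) ℝ)
    (φ u : EuclideanSpace ℝ (Fin n) → ℝ) (y : EuclideanSpace ℝ (Fin n)) : ℝ :=
  laplacian G u y - gradInner G φ u y

/-! ### Riemannian manifolds -/

/-- Smooth Riemannian metrics on the manifold `M`. -/
abbrev Metric (n : ℕ) (M : Type*) [TopologicalSpace M]
    [ChartedSpace (EuclideanSpace ℝ (Fin n)) M] [IsManifold (𝓡 n) ∞ M] :=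
  Bundle.ContMDiffRiemannianMetric (𝓡 n) ∞ (EuclideanSpace ℝ (Fin n))
    (fun p : M => TangentSpace (𝓡 n) p)

/-- The smooth charts of `M` (the maximal smooth atlas). -/
abbrev charts (n : ℕ) (M : Type*) [TopologicalSpace M]
    [ChartedSpace (EuclideanSpace ℝ (Fin n)) M] :
    Set (OpenPartialHomeomorph M (EuclideanSpace ℝ (Fin n))) :=
  IsManifold.maximalAtlas (𝓡 n) ∞ M

/-- The coordinate vector field `∂_i` of the chart `e`, at the point with coordinates `y`. -/
def coordVector {n : ℕ} {M : Type*} [TopologicalSpace M]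
    [ChartedSpace (EuclideanSpace ℝ (Fin n)) M]
    (e : OpenPartialHomeomorph M (EuclideanSpace ℝ (Fin n))) (i : Fin n)
    (y : EuclideanSpace ℝ (Fin n)) : TangentSpace (𝓡 n) (e.symm y) :=
  mfderiv (𝓡 n) (𝓡 n) e.symm y (EuclideanSpace.single i (1 : ℝ) : EuclideanSpace ℝ (Fin n))

/-- The matrix `g_ij = g(∂_i, ∂_j)` of the metric in the chart `e`, as a function of the
coordinates. -/
def gram {n : ℕ} {M : Type*} [TopologicalSpace M]
    [ChartedSpace (EuclideanSpace ℝ (Fin n)) M] [IsManifold (𝓡 n) ∞ M] (g : Metric n M)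
    (e : OpenPartialHomeomorph M (EuclideanSpace ℝ (Fin n)))
    (y : EuclideanSpace ℝ (Fin n)) : Matrix (Fin n) (Fin n) ℝ :=
  Matrix.of fun i j => g.inner (e.symm y) (coordVector e i y) (coordVector e j y)

/-- The measure `√(det g_ij) dy` of the chart `e`, as a measure on `M` which is carried by the
domain of `e`. -/
def chartVolume {n : ℕ} {M : Type*} [TopologicalSpace M]
    [ChartedSpace (EuclideanSpace ℝ (Fin n)) M] [IsManifold (𝓡 n) ∞ M] [MeasurableSpace M]
    (g : Metric n M) (e : OpenPartialHomeomorph M (EuclideanSpace ℝ (Fin n))) :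
    MeasureTheory.Measure M :=
  ((MeasureTheory.volume.restrict e.target).withDensity
    fun y => ENNReal.ofReal (Real.sqrt (gram g e y).det)).map e.symm

/-- The Riemannian volume measure `dV_g`. By the change of variables formula, the measures
`√(det g_ij) dy` of two charts agree on the intersection of their domains. Hence their supremum
(the least measure that dominates all of them) is the measure that restricts to
`√(det g_ij) dy` on the domain of every chart. -/
def volume {n : ℕ} {M : Type*} [TopologicalSpace M]
    [ChartedSpace (EuclideanSpace ℝ (Fin n)) M] [IsManifold (𝓡 n) ∞ M] [MeasurableSpace M]
    (g : Metric n M) : MeasureTheory.Measure M :=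
  ⨆ e ∈ charts n M, chartVolume g e

/-- The gradient Ricci soliton equation `R_ij - γ g_ij + ∇_i ∇_j f = 0`, in the coordinates of
every smooth chart. Its left-hand side is a tensor, so that any atlas would do. -/
def IsGradientSoliton {n : ℕ} {M : Type*} [TopologicalSpace M]
    [ChartedSpace (EuclideanSpace ℝ (Fin n)) M] [IsManifold (𝓡 n) ∞ M]
    (g : Metric n M) (f : M → ℝ) (γ : ℝ) : Prop :=
  ∀ e ∈ charts n M, ∀ y ∈ e.target, ∀ i j : Fin n,
    ricci (gram g e) i j y - γ * gram g e y i j + hessian (gram g e) (f ∘ e.symm) i j y = 0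

/-- The equation `Δ_φ u = c u` on `M`: in every smooth chart, the coordinate expression of the
Bakry-Émery Laplacian of `u` equals that of `c u`. Both sides are scalars, so that any atlas
would do. -/
def BakryEmeryEigenEq {n : ℕ} {M : Type*} [TopologicalSpace M]
    [ChartedSpace (EuclideanSpace ℝ (Fin n)) M] [IsManifold (𝓡 n) ∞ M]
    (g : Metric n M) (φ u : M → ℝ) (c : ℝ) : Prop :=
  ∀ e ∈ charts n M, ∀ p ∈ e.source,
    bakryEmeryLaplacian (gram g e) (φ ∘ e.symm) (u ∘ e.symm) (e p) = c * u p

end Riem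

end

/-!
The proof has a local and a global part.

Locally, `Δ_f f + 2 γ f` has vanishing gradient for every gradient soliton. Write the soliton
equation as `R_ij = γ g_ij - ∇_i ∇_j f` and insert it into the contracted second Bianchi identity
`∇_m R = 2 ∇^j R_jm`. This gives `∇_m Δ f = 2 ∇^j ∇_j ∇_m f`, and the Ricci identity
`∇^j ∇_j ∇_m f = ∇_m Δ f + R_ml ∇^l f` turns it into
`∇_m Δ f = -2 R_ml ∇^l f = -2 γ ∇_m f + ∇_m |∇ f|²`. The soliton equation is available in every
chart of the maximal atlas, so each point may be treated as the origin of coordinates in which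
`g_ij = δ_ij` and `∂_a g_ij = 0`. In such coordinates the two identities reduce to the symmetry of
the third and second derivatives of `g_ij`
(`IsNormalAt.contracted_bianchi`, `IsNormalAt.ricci_identity`). The coordinates exist by the inverse
function theorem (`exists_normal_chart`).

Globally, `Δ_f f + 2 γ f` is then a constant on the connected manifold `M`, provided that `Δ_f f` is
a well-defined function on `M`. The constant is zero because both `Δ_f f` and `f` have integral zero
for the measure `e^{-f} dV_g`. Both missing facts follow from the divergence form
`√g e^{-φ} Δ_φ u = ∂_i (√g e^{-φ} g^{ij} ∂_j u)` (`sum_pderiv_flux`): for a test function `η` that is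
supported in the domain of a chart it gives
`∫ η Δ_φ u e^{-φ} dV_g = -∫ ∇η · ∇u e^{-φ} dV_g` (`integral_mul_bakryEmery`). The right-hand side is
independent of the chart, since `∇η · ∇u` is and since the volume restricts to `√g dy` on the domain
of each chart (`volume_restrict_source`); hence so is `Δ_φ u` (`bakryEmery_eq_of_mem`). Summing over
a partition of unity, whose gradients add up to zero, gives `∫ Δ_φ u e^{-φ} dV_g = 0`
(`integral_bakryEmery_eq_zero`).
-/

noncomputable section

namespace Riem

open Filter Topology

/-! ### Calculus of partial derivatives -/

section PartialDerivatives

variable {n : ℕ} {f h : EuclideanSpace ℝ (Fin n) → ℝ} {y : EuclideanSpace ℝ (Fin n)}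

theorem contDiffAt_pderiv (hf : ContDiffAt ℝ ∞ f y) (i : Fin n) :
    ContDiffAt ℝ ∞ (pderiv i f) y :=
  (hf.fderiv_right (m := ∞) (by simp)).clm_apply contDiffAt_const

theorem differentiableAt_of_smooth (hf : ContDiffAt ℝ ∞ f y) : DifferentiableAt ℝ f y :=
  hf.differentiableAt (by simp)

theorem eventually_differentiableAt (hf : ContDiffAt ℝ ∞ f y) :
    ∀ᶠ z in 𝓝 y, DifferentiableAt ℝ f z :=
  ((hf.of_le (m := 1) (by simp)).eventually (by simp)).mono
    fun _ hz => hz.differentiableAt (by simp)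

theorem pderiv_congr (hfh : f =ᶠ[𝓝 y] h) (i : Fin n) : pderiv i f y = pderiv i h y := by
  simp only [pderiv, hfh.fderiv_eq]

theorem pderiv_congr_eventually (hfh : f =ᶠ[𝓝 y] h) (i : Fin n) :
    pderiv i f =ᶠ[𝓝 y] pderiv i h :=
  hfh.eventuallyEq_nhds.mono fun _ hz => pderiv_congr hz i

theorem pderiv_const (i : Fin n) (c : ℝ) (y : EuclideanSpace ℝ (Fin n)) :
    pderiv i (fun _ => c) y = 0 := by
  simp [pderiv]

theorem pderiv_add (hf : DifferentiableAt ℝ f y) (hh : DifferentiableAt ℝ h y) (i : Fin n) :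
    pderiv i (fun z => f z + h z) y = pderiv i f y + pderiv i h y := by
  simp [pderiv, fderiv_fun_add hf hh]

theorem pderiv_sub (hf : DifferentiableAt ℝ f y) (hh : DifferentiableAt ℝ h y) (i : Fin n) :
    pderiv i (fun z => f z - h z) y = pderiv i f y - pderiv i h y := by
  simp [pderiv, fderiv_fun_sub hf hh]

theorem pderiv_mul (hf : DifferentiableAt ℝ f y) (hh : DifferentiableAt ℝ h y) (i : Fin n) :
    pderiv i (fun z => f z * h z) y = pderiv i f y * h y + f y * pderiv i h y := by
  simp [pderiv, fderiv_fun_mul hf hh]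
  ring

theorem pderiv_const_mul (hf : DifferentiableAt ℝ f y) (c : ℝ) (i : Fin n) :
    pderiv i (fun z => c * f z) y = c * pderiv i f y := by
  simp [pderiv, fderiv_const_mul hf]

theorem pderiv_sum {ι : Type*} (s : Finset ι) {F : ι → EuclideanSpace ℝ (Fin n) → ℝ}
    (hF : ∀ a ∈ s, DifferentiableAt ℝ (F a) y) (i : Fin n) :
    pderiv i (fun z => ∑ a ∈ s, F a z) y = ∑ a ∈ s, pderiv i (F a) y := by
  simp [pderiv, fderiv_fun_sum hF]

theorem pderiv_comm (hf : ContDiffAt ℝ 2 f y) (i j : Fin n) :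
    pderiv i (pderiv j f) y = pderiv j (pderiv i f) y := by
  have hd : DifferentiableAt ℝ (fderiv ℝ f) y :=
    (hf.fderiv_right (m := 1) (by norm_num)).differentiableAt (by simp)
  have key : ∀ a b : Fin n, pderiv a (pderiv b f) y
      = fderiv ℝ (fderiv ℝ f) y (EuclideanSpace.single a 1) (EuclideanSpace.single b 1) := by
    intro a b
    have hb : pderiv b f
        = fun z => (fderiv ℝ f z) ((fun _ => EuclideanSpace.single b (1 : ℝ)) z) := rfl
    rw [hb, pderiv, fderiv_clm_apply hd (differentiableAt_const _)]
    simp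
  rw [key, key]
  exact (hf.isSymmSndFDerivAt (by simp)).eq _ _

theorem pderiv_comm_eventually (hf : ContDiffAt ℝ ∞ f y) (i j : Fin n) :
    pderiv i (pderiv j f) =ᶠ[𝓝 y] pderiv j (pderiv i f) :=
  ((hf.of_le ENat.LEInfty.out).eventually (by simp)).mono fun _ hz => pderiv_comm hz i j

theorem pderiv_comp_real {φ : ℝ → ℝ} {φ' : ℝ} (hφ : HasDerivAt φ φ' (f y))
    (hf : DifferentiableAt ℝ f y) (i : Fin n) :
    pderiv i (fun z => φ (f z)) y = φ' * pderiv i f y := by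
  have := (hφ.comp_hasFDerivAt y hf.hasFDerivAt).fderiv
  simp only [pderiv]
  rw [show (fun z => φ (f z)) = φ ∘ f from rfl, this]
  simp

/-- Expansion of a derivative in the standard basis. -/
theorem fderiv_apply_eq_sum_pderiv (f : EuclideanSpace ℝ (Fin n) → ℝ)
    (y v : EuclideanSpace ℝ (Fin n)) : fderiv ℝ f y v = ∑ i, v i * pderiv i f y := by
  conv_lhs => rw [show v = ∑ i, v i • EuclideanSpace.single i (1 : ℝ) by
    simpa using ((EuclideanSpace.basisFun (Fin n) ℝ).sum_repr v).symm]
  simp [pderiv]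

variable {G : EuclideanSpace ℝ (Fin n) → Matrix (Fin n) (Fin n) ℝ}

theorem contDiffAt_det {X : Type*} [NormedAddCommGroup X] [NormedSpace ℝ X] {x : X}
    {A : X → Matrix (Fin n) (Fin n) ℝ}
    (hA : ∀ i j, ContDiffAt ℝ ∞ (fun z => A z i j) x) :
    ContDiffAt ℝ ∞ (fun z => (A z).det) x := by
  simp only [Matrix.det_apply]
  refine ContDiffAt.sum fun σ _ => ?_
  simp only [Units.smul_def, zsmul_eq_mul]
  exact contDiffAt_const.mul (contDiffAt_prod fun i _ => hA _ _)

theorem contDiffAt_inv (hG : ∀ i j, ContDiffAt ℝ ∞ (fun z => G z i j) y)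
    (h0 : (G y).det ≠ 0) (i j : Fin n) : ContDiffAt ℝ ∞ (fun z => (G z)⁻¹ i j) y := by
  simp only [Matrix.inv_def, Matrix.smul_apply, smul_eq_mul, Ring.inverse_eq_inv']
  refine ((contDiffAt_det hG).inv h0).mul ?_
  simp only [Matrix.adjugate_apply]
  refine contDiffAt_det fun k l => ?_
  simp only [Matrix.updateRow_apply]
  by_cases hk : k = j
  · simp only [hk, if_true]; exact contDiffAt_const
  · simp only [hk, if_false]; exact hG k l

theorem eventually_det_ne_zero (hG : ∀ i j, ContDiffAt ℝ ∞ (fun z => G z i j) y)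
    (h0 : (G y).det ≠ 0) : ∀ᶠ z in 𝓝 y, (G z).det ≠ 0 :=
  (contDiffAt_det hG).continuousAt.eventually_ne h0

theorem sum_inv_mul {A : Matrix (Fin n) (Fin n) ℝ} (h0 : A.det ≠ 0) (i j : Fin n) :
    ∑ k, A⁻¹ i k * A k j = if i = j then 1 else 0 := by
  have := Matrix.nonsing_inv_mul A (isUnit_iff_ne_zero.mpr h0)
  rw [← Matrix.mul_apply, this, Matrix.one_apply]

theorem sum_mul_inv {A : Matrix (Fin n) (Fin n) ℝ} (h0 : A.det ≠ 0) (i j : Fin n) :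
    ∑ k, A i k * A⁻¹ k j = if i = j then 1 else 0 := by
  have := Matrix.mul_nonsing_inv A (isUnit_iff_ne_zero.mpr h0)
  rw [← Matrix.mul_apply, this, Matrix.one_apply]

/-- The derivative of the inverse matrix, `∂(G⁻¹) = -G⁻¹ (∂G) G⁻¹`. -/
theorem pderiv_inv (hG : ∀ i j, ContDiffAt ℝ ∞ (fun z => G z i j) y)
    (h0 : (G y).det ≠ 0) (a i j : Fin n) :
    pderiv a (fun z => (G z)⁻¹ i j) y
      = -∑ k, ∑ l, (G y)⁻¹ i k * pderiv a (fun z => G z k l) y * (G y)⁻¹ l j := by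
  have hN := contDiffAt_inv hG h0
  have h1 : ∀ l, ∑ k, (pderiv a (fun z => (G z)⁻¹ i k) y * G y k l
      + (G y)⁻¹ i k * pderiv a (fun z => G z k l) y) = 0 := by
    intro l
    have hev : (fun z => ∑ k, (G z)⁻¹ i k * G z k l) =ᶠ[𝓝 y]
        fun _ => if i = l then (1:ℝ) else 0 :=
      (eventually_det_ne_zero hG h0).mono fun z hz => sum_inv_mul hz i l
    have := pderiv_congr hev a
    rw [pderiv_const, pderiv_sum Finset.univ (F := fun k z => (G z)⁻¹ i k * G z k l)
      (fun k _ => (differentiableAt_of_smooth (hN i k)).mul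
      (differentiableAt_of_smooth (hG k l)))] at this
    rw [← this]
    exact Finset.sum_congr rfl fun k _ => (pderiv_mul (differentiableAt_of_smooth (hN i k))
      (differentiableAt_of_smooth (hG k l)) a).symm
  have h2 : ∑ l, (∑ k, (pderiv a (fun z => (G z)⁻¹ i k) y * G y k l
      + (G y)⁻¹ i k * pderiv a (fun z => G z k l) y)) * (G y)⁻¹ l j = 0 := by
    simp [h1]
  simp only [Finset.sum_mul, add_mul, Finset.sum_add_distrib] at h2
  rw [Finset.sum_comm] at h2
  simp only [mul_assoc, ← Finset.mul_sum, sum_mul_inv h0] at h2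
  simp only [mul_ite, mul_one, mul_zero, Finset.sum_ite_eq',
    Finset.mem_univ, if_true] at h2
  rw [eq_neg_iff_add_eq_zero, ← h2, Finset.sum_comm]
  simp [mul_assoc]

/-- Jacobi's formula `∂(det G) = det G · tr(G⁻¹ ∂G)`. -/
theorem pderiv_det (hG : ∀ i j, ContDiffAt ℝ ∞ (fun z => G z i j) y)
    (h0 : (G y).det ≠ 0) (a : Fin n) :
    pderiv a (fun z => (G z).det) y
      = (G y).det * ∑ k, ∑ l, (G y)⁻¹ k l * pderiv a (fun z => G z l k) y := by
  set D : (Fin n → Fin n → ℝ) → ℝ := fun A => (Matrix.of A).det with hD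
  set H : Matrix (Fin n) (Fin n) ℝ := Matrix.of fun k l => pderiv a (fun z => G z k l) y with hH
  have hDs : ContDiffAt ℝ ∞ D (fun k l => G y k l) :=
    contDiffAt_det (A := fun A : Fin n → Fin n → ℝ => Matrix.of A) fun i j =>
      ((contDiff_apply_apply ℝ ℝ i j).contDiffAt)
  have hGd : HasFDerivAt (fun z k l => G z k l)
      (ContinuousLinearMap.pi fun k => ContinuousLinearMap.pi fun l =>
        fderiv ℝ (fun z => G z k l) y) y :=
    hasFDerivAt_pi.2 fun k => hasFDerivAt_pi.2 fun l =>
      (differentiableAt_of_smooth (hG k l)).hasFDerivAt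
  have hDd := (hDs.differentiableAt (by simp)).hasFDerivAt
  have h1 : pderiv a (fun z => (G z).det) y
      = fderiv ℝ D (fun k l => G y k l) (fun k l => H k l) := by
    have := (hDd.comp y hGd).fderiv
    simp only [pderiv]
    rw [show (fun z => (G z).det) = D ∘ (fun z k l => G z k l) from rfl, this]
    rfl
  have hline : HasDerivAt (fun t : ℝ => (fun k l => G y k l + t * H k l : Fin n → Fin n → ℝ))
      (fun k l => H k l) 0 := by
    refine hasDerivAt_pi.2 fun k => hasDerivAt_pi.2 fun l => ?_
    simpa using ((hasDerivAt_id (0:ℝ)).mul_const (H k l)).const_add (G y k l)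
  have h2 : HasDerivAt (fun t : ℝ => D (fun k l => G y k l + t * H k l))
      (fderiv ℝ D (fun k l => G y k l) (fun k l => H k l)) 0 := by
    have := HasFDerivAt.comp_hasDerivAt (f := fun t : ℝ =>
      (fun k l => G y k l + t * H k l : Fin n → Fin n → ℝ)) (l := D) (0 : ℝ)
      (by simpa using hDd) hline
    exact this
  have h3 : ∀ t : ℝ, D (fun k l => G y k l + t * H k l)
      = (G y).det * (1 + t • ((G y)⁻¹ * H)).det := by
    intro t
    rw [← Matrix.det_mul, Matrix.mul_add, Matrix.mul_one, Matrix.mul_smul, ← Matrix.mul_assoc,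
      Matrix.mul_nonsing_inv _ (isUnit_iff_ne_zero.mpr h0), Matrix.one_mul]
    rfl
  have h4 : HasDerivAt (fun t : ℝ => D (fun k l => G y k l + t * H k l))
      ((G y).det * ((G y)⁻¹ * H).trace) 0 := by
    simp only [h3]
    refine HasDerivAt.const_mul _ ?_
    generalize (G y)⁻¹ * H = K
    set P := ((1 : Matrix (Fin n) (Fin n) (Polynomial ℝ))
      + (Polynomial.X : Polynomial ℝ) • K.map Polynomial.C).det with hP
    have hev : ∀ t : ℝ, (1 + t • K).det = P.eval t := by
      intro t
      rw [hP, ← Polynomial.coe_evalRingHom, RingHom.map_det]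
      congr 1
      ext i j
      simp [Matrix.one_apply, apply_ite (Polynomial.eval t)]
      ring
    simp only [hev]
    have := P.hasDerivAt 0
    rwa [hP, Matrix.derivative_det_one_add_X_smul] at this
  rw [h1, h2.unique h4, Matrix.trace]
  simp [Matrix.mul_apply, hH]

end PartialDerivatives

/-! ### Curvature identities at the origin of normal coordinates -/

section

variable {n : ℕ} {f h N : EuclideanSpace ℝ (Fin n) → ℝ} {y : EuclideanSpace ℝ (Fin n)}

theorem pderiv_mul_of_eq_zero (hN : DifferentiableAt ℝ N y) (hf : DifferentiableAt ℝ f y)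
    (h0 : f y = 0) (a : Fin n) : pderiv a (fun z => N z * f z) y = N y * pderiv a f y := by
  rw [pderiv_mul hN hf, h0]; ring

/-- If `f` and the derivatives of `N` vanish at `y`, then `N` may be treated as a constant in second
derivatives of `N f` at `y`. -/
theorem pderiv_pderiv_mul_of_eq_zero (hN : ContDiffAt ℝ ∞ N y) (hf : ContDiffAt ℝ ∞ f y)
    (h0 : f y = 0) (hN0 : ∀ a, pderiv a N y = 0) (b a : Fin n) :
    pderiv b (pderiv a (fun z => N z * f z)) y = N y * pderiv b (pderiv a f) y := by
  have hev : pderiv a (fun z => N z * f z) =ᶠ[𝓝 y]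
      fun z => pderiv a N z * f z + N z * pderiv a f z := by
    filter_upwards [eventually_differentiableAt hN, eventually_differentiableAt hf] with z h1 h2
    exact pderiv_mul h1 h2 a
  have dN := differentiableAt_of_smooth hN
  have df := differentiableAt_of_smooth hf
  have dN' := differentiableAt_of_smooth (contDiffAt_pderiv hN a)
  have df' := differentiableAt_of_smooth (contDiffAt_pderiv hf a)
  rw [pderiv_congr hev, pderiv_add (dN'.fun_mul df) (dN.fun_mul df'), pderiv_mul dN' df,
    pderiv_mul dN df', h0, hN0, hN0]
  ring

theorem pderiv_pderiv_sum {ι : Type*} (s : Finset ι) {F : ι → EuclideanSpace ℝ (Fin n) → ℝ}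
    (hF : ∀ a ∈ s, ContDiffAt ℝ ∞ (F a) y) (b a : Fin n) :
    pderiv b (pderiv a (fun z => ∑ i ∈ s, F i z)) y
      = ∑ i ∈ s, pderiv b (pderiv a (F i)) y := by
  have hev : pderiv a (fun z => ∑ i ∈ s, F i z) =ᶠ[𝓝 y]
      fun z => ∑ i ∈ s, pderiv a (F i) z := by
    filter_upwards [(Finset.eventually_all s).2 fun i hi => eventually_differentiableAt (hF i hi)]
      with z h1
    exact pderiv_sum s h1 a
  rw [pderiv_congr hev, pderiv_sum s
    fun i hi => differentiableAt_of_smooth (contDiffAt_pderiv (hF i hi) a)]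

/-- The Christoffel symbols of the first kind,
`Γ_lij = ½ (∂_i g_jl + ∂_j g_il - ∂_l g_ij)`. -/
def christoffelFirst (G : EuclideanSpace ℝ (Fin n) → Matrix (Fin n) (Fin n) ℝ)
    (l i j : Fin n) (y : EuclideanSpace ℝ (Fin n)) : ℝ :=
  (1 / 2 : ℝ) * (pderiv i (fun z => G z j l) y + pderiv j (fun z => G z i l) y
      - pderiv l (fun z => G z i j) y)

variable {G : EuclideanSpace ℝ (Fin n) → Matrix (Fin n) (Fin n) ℝ}

theorem christoffel_eq_sum (k i j : Fin n) :
    christoffel G k i j = fun y => ∑ l, (G y)⁻¹ k l * christoffelFirst G l i j y := by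
  funext y
  simp only [christoffel, christoffelFirst, Finset.mul_sum]
  exact Finset.sum_congr rfl fun l _ => by ring

theorem contDiffAt_christoffelFirst (hG : ∀ i j, ContDiffAt ℝ ∞ (fun z => G z i j) y)
    (l i j : Fin n) : ContDiffAt ℝ ∞ (christoffelFirst G l i j) y :=
  contDiffAt_const.mul (((contDiffAt_pderiv (hG j l) i).add (contDiffAt_pderiv (hG i l) j)).sub
    (contDiffAt_pderiv (hG i j) l))

theorem contDiffAt_christoffel (hG : ∀ i j, ContDiffAt ℝ ∞ (fun z => G z i j) y)
    (h0 : (G y).det ≠ 0) (k i j : Fin n) : ContDiffAt ℝ ∞ (christoffel G k i j) y := by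
  rw [christoffel_eq_sum]
  exact ContDiffAt.sum fun l _ => (contDiffAt_inv hG h0 k l).mul
    (contDiffAt_christoffelFirst hG l i j)

theorem contDiffAt_hessian (hG : ∀ i j, ContDiffAt ℝ ∞ (fun z => G z i j) y)
    (h0 : (G y).det ≠ 0) (hf : ContDiffAt ℝ ∞ f y) (i j : Fin n) :
    ContDiffAt ℝ ∞ (hessian G f i j) y :=
  (contDiffAt_pderiv (contDiffAt_pderiv hf j) i).sub (ContDiffAt.sum fun k _ =>
    (contDiffAt_christoffel hG h0 k i j).mul (contDiffAt_pderiv hf k))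

theorem pderiv_christoffelFirst (hG : ∀ i j, ContDiffAt ℝ ∞ (fun z => G z i j) y)
    (a l i j : Fin n) :
    pderiv a (christoffelFirst G l i j) y = (1 / 2 : ℝ) *
      (pderiv a (pderiv i (fun z => G z j l)) y + pderiv a (pderiv j (fun z => G z i l)) y
        - pderiv a (pderiv l (fun z => G z i j)) y) := by
  have d : ∀ p q r, DifferentiableAt ℝ (pderiv p (fun z => G z q r)) y :=
    fun p q r => differentiableAt_of_smooth (contDiffAt_pderiv (hG q r) p)
  rw [← pderiv_add (d _ _ _) (d _ _ _), ← pderiv_sub ((d _ _ _).fun_add (d _ _ _)) (d _ _ _),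
    ← pderiv_const_mul (((d _ _ _).fun_add (d _ _ _)).fun_sub (d _ _ _))]
  rfl

theorem pderiv_pderiv_christoffelFirst (hG : ∀ i j, ContDiffAt ℝ ∞ (fun z => G z i j) y)
    (b a l i j : Fin n) :
    pderiv b (pderiv a (christoffelFirst G l i j)) y = (1 / 2 : ℝ) *
      (pderiv b (pderiv a (pderiv i (fun z => G z j l))) y
        + pderiv b (pderiv a (pderiv j (fun z => G z i l))) y
        - pderiv b (pderiv a (pderiv l (fun z => G z i j))) y) := by
  have s : ∀ p q r, ContDiffAt ℝ ∞ (pderiv p (fun z => G z q r)) y :=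
    fun p q r => contDiffAt_pderiv (hG q r) p
  have hev : pderiv a (christoffelFirst G l i j) =ᶠ[𝓝 y] fun z => (1 / 2 : ℝ) *
      (pderiv a (pderiv i (fun z => G z j l)) z + pderiv a (pderiv j (fun z => G z i l)) z
        - pderiv a (pderiv l (fun z => G z i j)) z) := by
    filter_upwards [eventually_differentiableAt (s i j l), eventually_differentiableAt (s j i l),
      eventually_differentiableAt (s l i j)] with z h1 h2 h3
    rw [← pderiv_add h1 h2, ← pderiv_sub (h1.fun_add h2) h3,
      ← pderiv_const_mul ((h1.fun_add h2).fun_sub h3)]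
    rfl
  have d : ∀ p q r, DifferentiableAt ℝ (pderiv a (pderiv p (fun z => G z q r))) y :=
    fun p q r => differentiableAt_of_smooth (contDiffAt_pderiv (s p q r) a)
  rw [pderiv_congr hev, pderiv_const_mul (((d _ _ _).fun_add (d _ _ _)).fun_sub (d _ _ _)),
    pderiv_sub ((d _ _ _).fun_add (d _ _ _)) (d _ _ _), pderiv_add (d _ _ _) (d _ _ _)]

end

section NormalCoordinates

variable {n : ℕ} {f : EuclideanSpace ℝ (Fin n) → ℝ} {y : EuclideanSpace ℝ (Fin n)}
  {G : EuclideanSpace ℝ (Fin n) → Matrix (Fin n) (Fin n) ℝ}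

/-- The coordinates are normal to first order at `y` for the metric `G`: there `g_ij = δ_ij` and
`∂_a g_ij = 0`. -/
structure IsNormalAt (G : EuclideanSpace ℝ (Fin n) → Matrix (Fin n) (Fin n) ℝ)
    (y : EuclideanSpace ℝ (Fin n)) : Prop where
  smooth : ∀ i j, ContDiffAt ℝ ∞ (fun z => G z i j) y
  symm : ∀ᶠ z in 𝓝 y, ∀ i j, G z i j = G z j i
  eq_one : G y = 1
  pderiv_eq_zero : ∀ a i j, pderiv a (fun z => G z i j) y = 0

namespace IsNormalAt

theorem det_ne_zero (hG : IsNormalAt G y) : (G y).det ≠ 0 := by simp [hG.eq_one]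

theorem inv_apply (hG : IsNormalAt G y) (i j : Fin n) :
    (G y)⁻¹ i j = if i = j then 1 else 0 := by
  simp [hG.eq_one, Matrix.one_apply]

theorem contDiffAt_inv (hG : IsNormalAt G y) (i j : Fin n) :
    ContDiffAt ℝ ∞ (fun z => (G z)⁻¹ i j) y :=
  Riem.contDiffAt_inv hG.smooth hG.det_ne_zero i j

theorem pderiv_inv (hG : IsNormalAt G y) (a i j : Fin n) :
    pderiv a (fun z => (G z)⁻¹ i j) y = 0 := by
  rw [Riem.pderiv_inv hG.smooth hG.det_ne_zero]
  simp [hG.pderiv_eq_zero]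

theorem christoffelFirst_eq_zero (hG : IsNormalAt G y) (l i j : Fin n) :
    christoffelFirst G l i j y = 0 := by
  simp [christoffelFirst, hG.pderiv_eq_zero]

theorem christoffel_eq_zero (hG : IsNormalAt G y) (k i j : Fin n) :
    christoffel G k i j y = 0 := by
  simp [christoffel_eq_sum, hG.christoffelFirst_eq_zero]

theorem contDiffAt_christoffel (hG : IsNormalAt G y) (k i j : Fin n) :
    ContDiffAt ℝ ∞ (christoffel G k i j) y :=
  Riem.contDiffAt_christoffel hG.smooth hG.det_ne_zero k i j

theorem differentiableAt_christoffel (hG : IsNormalAt G y) (k i j : Fin n) :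
    DifferentiableAt ℝ (christoffel G k i j) y :=
  differentiableAt_of_smooth (hG.contDiffAt_christoffel k i j)

/-- Since the Christoffel symbols of the first kind and the derivatives of `g^{kl}` vanish, the
index of `Γ^k_ij` may be lowered under one derivative. -/
theorem pderiv_christoffel (hG : IsNormalAt G y) (a k i j : Fin n) :
    pderiv a (christoffel G k i j) y = pderiv a (christoffelFirst G k i j) y := by
  have hS := contDiffAt_christoffelFirst hG.smooth
  rw [christoffel_eq_sum, pderiv_sum Finset.univ
    (F := fun l z => (G z)⁻¹ k l * christoffelFirst G l i j z) fun l _ =>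
      differentiableAt_of_smooth ((hG.contDiffAt_inv k l).mul (hS l i j))]
  simp only [pderiv_mul_of_eq_zero (differentiableAt_of_smooth (hG.contDiffAt_inv _ _))
    (differentiableAt_of_smooth (hS _ _ _)) (hG.christoffelFirst_eq_zero _ _ _), hG.inv_apply]
  simp

/-- The index of `Γ^k_ij` may also be lowered under two derivatives. -/
theorem pderiv_pderiv_christoffel (hG : IsNormalAt G y) (b a k i j : Fin n) :
    pderiv b (pderiv a (christoffel G k i j)) y
      = pderiv b (pderiv a (christoffelFirst G k i j)) y := by
  have hS := contDiffAt_christoffelFirst hG.smooth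
  rw [christoffel_eq_sum, pderiv_pderiv_sum Finset.univ
    (F := fun l z => (G z)⁻¹ k l * christoffelFirst G l i j z) fun l _ =>
      (hG.contDiffAt_inv k l).mul (hS l i j)]
  simp only [pderiv_pderiv_mul_of_eq_zero (hG.contDiffAt_inv _ _)
    (hS _ _ _) (hG.christoffelFirst_eq_zero _ _ _) (fun a => hG.pderiv_inv a _ _), hG.inv_apply]
  simp

theorem pderiv_metric_symm (hG : IsNormalAt G y) (b a i j : Fin n) :
    pderiv b (pderiv a (fun z => G z i j)) y = pderiv b (pderiv a (fun z => G z j i)) y :=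
  pderiv_congr (pderiv_congr_eventually (hG.symm.mono fun _ hz => hz i j) a) b

theorem pderiv_pderiv_metric_symm (hG : IsNormalAt G y) (c b a i j : Fin n) :
    pderiv c (pderiv b (pderiv a (fun z => G z i j))) y
      = pderiv c (pderiv b (pderiv a (fun z => G z j i))) y :=
  pderiv_congr (pderiv_congr_eventually
    (pderiv_congr_eventually (hG.symm.mono fun _ hz => hz i j) a) b) c

theorem pderiv_metric_comm (hG : IsNormalAt G y) (b a i j : Fin n) :
    pderiv b (pderiv a (fun z => G z i j)) y = pderiv a (pderiv b (fun z => G z i j)) y :=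
  (pderiv_comm_eventually (hG.smooth i j) b a).self_of_nhds

theorem pderiv_metric_comm_left (hG : IsNormalAt G y) (c b a i j : Fin n) :
    pderiv c (pderiv b (pderiv a (fun z => G z i j))) y
      = pderiv b (pderiv c (pderiv a (fun z => G z i j))) y :=
  (pderiv_comm_eventually (contDiffAt_pderiv (hG.smooth i j) a) c b).self_of_nhds

theorem pderiv_metric_comm_right (hG : IsNormalAt G y) (c b a i j : Fin n) :
    pderiv c (pderiv b (pderiv a (fun z => G z i j))) y
      = pderiv c (pderiv a (pderiv b (fun z => G z i j))) y :=
  pderiv_congr (pderiv_comm_eventually (hG.smooth i j) b a) c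

/-- The Ricci tensor at the origin of normal coordinates, in terms of second derivatives of the
metric. -/
theorem ricci_eq (hG : IsNormalAt G y) (j k : Fin n) :
    ricci G j k y = ∑ i, (1 / 2 : ℝ) *
      (pderiv i (pderiv j (fun z => G z k i)) y + pderiv i (pderiv k (fun z => G z j i)) y
        - pderiv i (pderiv i (fun z => G z j k)) y - pderiv j (pderiv k (fun z => G z i i)) y) := by
  refine Finset.sum_congr rfl fun i _ => ?_
  simp only [curvature, hG.christoffel_eq_zero, hG.pderiv_christoffel,
    pderiv_christoffelFirst hG.smooth]
  rw [hG.pderiv_metric_symm j i k i]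
  simp
  ring

/-- The derivative of the Ricci tensor at the origin of normal coordinates, in terms of third
derivatives of the metric. -/
theorem pderiv_ricci (hG : IsNormalAt G y) (m j k : Fin n) :
    pderiv m (ricci G j k) y = ∑ i, (1 / 2 : ℝ) *
      (pderiv m (pderiv i (pderiv j (fun z => G z k i))) y
        + pderiv m (pderiv i (pderiv k (fun z => G z j i))) y
        - pderiv m (pderiv i (pderiv i (fun z => G z j k))) y
        - pderiv m (pderiv j (pderiv k (fun z => G z i i))) y) := by
  have hΓ := hG.differentiableAt_christoffel
  have hdΓ : ∀ a k i j, DifferentiableAt ℝ (pderiv a (christoffel G k i j)) y := fun a k i j =>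
    differentiableAt_of_smooth (contDiffAt_pderiv (hG.contDiffAt_christoffel k i j) a)
  have hq : ∀ l i j k p, DifferentiableAt ℝ (fun z => christoffel G p j k z * christoffel G l i p z
      - christoffel G p i k z * christoffel G l j p z) y := fun l i j k p =>
    ((hΓ p j k).fun_mul (hΓ l i p)).sub ((hΓ p i k).fun_mul (hΓ l j p))
  have hsum : ∀ l i j k, DifferentiableAt ℝ (fun z => ∑ p, (christoffel G p j k z *
      christoffel G l i p z - christoffel G p i k z * christoffel G l j p z)) y := fun l i j k =>
    DifferentiableAt.fun_sum fun p _ => hq l i j k p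
  have hquad : ∀ l i j k, pderiv m (fun z => ∑ p, (christoffel G p j k z *
      christoffel G l i p z - christoffel G p i k z * christoffel G l j p z)) y = 0 := by
    intro l i j k
    rw [pderiv_sum Finset.univ (F := fun p z => christoffel G p j k z *
      christoffel G l i p z - christoffel G p i k z * christoffel G l j p z)
      fun p _ => hq l i j k p]
    refine Finset.sum_eq_zero fun p _ => ?_
    rw [pderiv_sub ((hΓ p j k).fun_mul (hΓ l i p)) ((hΓ p i k).fun_mul (hΓ l j p)),
      pderiv_mul (hΓ p j k) (hΓ l i p), pderiv_mul (hΓ p i k) (hΓ l j p)]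
    simp [hG.christoffel_eq_zero]
  have hcurv : ∀ l i j k, DifferentiableAt ℝ (curvature G l i j k) y := fun l i j k =>
    ((hdΓ i l j k).sub (hdΓ j l i k)).add (hsum l i j k)
  have h1 : pderiv m (ricci G j k) y = ∑ i, pderiv m (curvature G i i j k) y :=
    pderiv_sum Finset.univ (F := fun i => curvature G i i j k) (fun i _ => hcurv i i j k) m
  rw [h1]
  refine Finset.sum_congr rfl fun i _ => ?_
  have h2 : pderiv m (curvature G i i j k) y
      = pderiv m (pderiv i (christoffel G i j k)) y - pderiv m (pderiv j (christoffel G i i k)) y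
        + 0 := by
    rw [← hquad i i j k, ← pderiv_sub (hdΓ _ _ _ _) (hdΓ _ _ _ _),
      ← pderiv_add ((hdΓ _ _ _ _).fun_sub (hdΓ _ _ _ _)) (hsum _ _ _ _)]
    rfl
  rw [h2]
  simp only [hG.pderiv_pderiv_christoffel, pderiv_pderiv_christoffelFirst hG.smooth]
  rw [hG.pderiv_pderiv_metric_symm m j i k i]
  ring

/-- The contracted second Bianchi identity `∇_m R = 2 ∇^j R_jm`. -/
theorem contracted_bianchi (hG : IsNormalAt G y) (m : Fin n) :
    ∑ j, pderiv m (ricci G j j) y = 2 * ∑ j, pderiv j (ricci G j m) y := by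
  simp only [hG.pderiv_ricci, Finset.mul_sum]
  have e1 : ∑ j, ∑ i, pderiv j (pderiv i (pderiv j (fun z => G z m i))) y
      = ∑ j, ∑ i, pderiv j (pderiv i (pderiv i (fun z => G z j m))) y := by
    rw [Finset.sum_comm]
    refine Finset.sum_congr rfl fun j _ => Finset.sum_congr rfl fun i _ => ?_
    rw [hG.pderiv_pderiv_metric_symm, hG.pderiv_metric_comm_left]
  have e2 : ∑ j, ∑ i, pderiv m (pderiv i (pderiv i (fun z => G z j j))) y
      = ∑ j, ∑ i, pderiv j (pderiv j (pderiv m (fun z => G z i i))) y := by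
    rw [Finset.sum_comm]
    refine Finset.sum_congr rfl fun j _ => Finset.sum_congr rfl fun i _ => ?_
    rw [hG.pderiv_metric_comm_left, hG.pderiv_metric_comm_right]
  have e3 : ∑ j, ∑ i, pderiv m (pderiv j (pderiv j (fun z => G z i i))) y
      = ∑ j, ∑ i, pderiv j (pderiv j (pderiv m (fun z => G z i i))) y := by
    refine Finset.sum_congr rfl fun j _ => Finset.sum_congr rfl fun i _ => ?_
    rw [hG.pderiv_metric_comm_left, hG.pderiv_metric_comm_right]
  have e4 : ∑ j, ∑ i, pderiv m (pderiv i (pderiv j (fun z => G z j i))) y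
      = ∑ j, ∑ i, pderiv j (pderiv i (pderiv m (fun z => G z j i))) y := by
    refine Finset.sum_congr rfl fun j _ => Finset.sum_congr rfl fun i _ => ?_
    rw [hG.pderiv_metric_comm_right, hG.pderiv_metric_comm_left, hG.pderiv_metric_comm_right]
  simp only [← Finset.mul_sum, Finset.sum_add_distrib, Finset.sum_sub_distrib, e1, e2, e3, e4]
  ring

theorem pderiv_hessian (hG : IsNormalAt G y) (hf : ContDiffAt ℝ ∞ f y) (m i j : Fin n) :
    pderiv m (hessian G f i j) y = pderiv m (pderiv i (pderiv j f)) y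
      - ∑ k, pderiv m (christoffel G k i j) y * pderiv k f y := by
  have hΓ := hG.differentiableAt_christoffel
  have hf1 : ∀ k, DifferentiableAt ℝ (pderiv k f) y := fun k =>
    differentiableAt_of_smooth (contDiffAt_pderiv hf k)
  have hp : ∀ k, DifferentiableAt ℝ (fun z => christoffel G k i j z * pderiv k f z) y :=
    fun k => (hΓ k i j).mul (hf1 k)
  have h1 : pderiv m (hessian G f i j) y = pderiv m (pderiv i (pderiv j f)) y
      - pderiv m (fun z => ∑ k, christoffel G k i j z * pderiv k f z) y := by
    rw [← pderiv_sub (differentiableAt_of_smooth (contDiffAt_pderiv (contDiffAt_pderiv hf j) i))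
      (DifferentiableAt.fun_sum fun k _ => hp k)]
    rfl
  rw [h1, pderiv_sum Finset.univ (F := fun k z => christoffel G k i j z * pderiv k f z)
    fun k _ => hp k]
  congr 1
  refine Finset.sum_congr rfl fun k _ => ?_
  rw [pderiv_mul (hΓ k i j) (hf1 k), hG.christoffel_eq_zero]
  ring

/-- The trace of the Ricci identity, `∇^j ∇_j ∇_m f - ∇_m Δ f = R_lm ∇^l f`. -/
theorem ricci_identity (hG : IsNormalAt G y) (hf : ContDiffAt ℝ ∞ f y) (m : Fin n) :
    ∑ j, pderiv j (hessian G f j m) y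
      = ∑ j, pderiv m (hessian G f j j) y + ∑ l, ricci G l m y * pderiv l f y := by
  have e1 : ∀ l, ricci G l m y
      = ∑ j, (pderiv m (christoffel G l j j) y - pderiv j (christoffel G l j m) y) := by
    intro l
    rw [hG.ricci_eq]
    refine Finset.sum_congr rfl fun j _ => ?_
    rw [hG.pderiv_christoffel, hG.pderiv_christoffel, pderiv_christoffelFirst hG.smooth,
      pderiv_christoffelFirst hG.smooth, hG.pderiv_metric_symm j l m j,
      hG.pderiv_metric_symm j m l j, hG.pderiv_metric_symm j j m l,
      hG.pderiv_metric_comm m j j l, hG.pderiv_metric_comm m l j j]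
    ring
  have e2 : ∀ j, pderiv j (pderiv j (pderiv m f)) y = pderiv m (pderiv j (pderiv j f)) y := by
    intro j
    rw [pderiv_congr (pderiv_comm_eventually hf j m) j]
    exact (pderiv_comm_eventually (contDiffAt_pderiv hf j) j m).self_of_nhds
  simp only [hG.pderiv_hessian hf, e1, e2, Finset.sum_sub_distrib, Finset.sum_mul, sub_mul]
  rw [Finset.sum_comm (f := fun l j => pderiv m (christoffel G l j j) y * pderiv l f y),
    Finset.sum_comm (f := fun l j => pderiv j (christoffel G l j m) y * pderiv l f y)]
  ring

theorem pderiv_laplacian (hG : IsNormalAt G y) (hf : ContDiffAt ℝ ∞ f y) (m : Fin n) :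
    pderiv m (laplacian G f) y = ∑ j, pderiv m (hessian G f j j) y := by
  have hN : ∀ i j, DifferentiableAt ℝ (fun z => (G z)⁻¹ i j) y := fun i j =>
    differentiableAt_of_smooth (hG.contDiffAt_inv i j)
  have hH : ∀ i j, DifferentiableAt ℝ (hessian G f i j) y := fun i j =>
    differentiableAt_of_smooth (contDiffAt_hessian hG.smooth hG.det_ne_zero hf i j)
  have h1 : pderiv m (laplacian G f) y
      = ∑ i, ∑ j, pderiv m (fun z => (G z)⁻¹ i j * hessian G f i j z) y := by
    rw [← Finset.sum_congr rfl fun i _ => pderiv_sum Finset.univ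
      (F := fun j z => (G z)⁻¹ i j * hessian G f i j z) (fun j _ => (hN i j).mul (hH i j)) m]
    exact pderiv_sum Finset.univ (F := fun i z => ∑ j, (G z)⁻¹ i j * hessian G f i j z)
      (fun i _ => DifferentiableAt.fun_sum fun j _ => (hN i j).mul (hH i j)) m
  rw [h1]
  simp only [pderiv_mul (hN _ _) (hH _ _), hG.pderiv_inv, hG.inv_apply]
  simp

theorem pderiv_gradInner_self (hG : IsNormalAt G y) (hf : ContDiffAt ℝ ∞ f y) (m : Fin n) :
    pderiv m (gradInner G f f) y = ∑ l, 2 * (pderiv m (pderiv l f) y * pderiv l f y) := by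
  have hN : ∀ i j, DifferentiableAt ℝ (fun z => (G z)⁻¹ i j) y := fun i j =>
    differentiableAt_of_smooth (hG.contDiffAt_inv i j)
  have hf1 : ∀ k, DifferentiableAt ℝ (pderiv k f) y := fun k =>
    differentiableAt_of_smooth (contDiffAt_pderiv hf k)
  have h1 : pderiv m (gradInner G f f) y
      = ∑ i, ∑ j, pderiv m (fun z => (G z)⁻¹ i j * pderiv i f z * pderiv j f z) y := by
    rw [← Finset.sum_congr rfl fun i _ => pderiv_sum Finset.univ
      (F := fun j z => (G z)⁻¹ i j * pderiv i f z * pderiv j f z)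
      (fun j _ => ((hN i j).fun_mul (hf1 i)).mul (hf1 j)) m]
    exact pderiv_sum Finset.univ
      (F := fun i z => ∑ j, (G z)⁻¹ i j * pderiv i f z * pderiv j f z)
      (fun i _ => DifferentiableAt.fun_sum fun j _ => ((hN i j).fun_mul (hf1 i)).mul (hf1 j)) m
  rw [h1]
  simp only [fun i j => pderiv_mul ((hN i j).fun_mul (hf1 i)) (hf1 j) m,
    fun i j => pderiv_mul (hN i j) (hf1 i) m, hG.pderiv_inv, hG.inv_apply]
  simp only [zero_mul, ite_mul, one_mul, zero_add, Finset.sum_add_distrib, Finset.sum_ite_eq,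
    Finset.mem_univ, if_true]
  rw [← Finset.sum_add_distrib]
  exact Finset.sum_congr rfl fun l _ => by ring

/-- For a gradient soliton the gradient of `Δ_f f + 2 γ f` vanishes. With
`X = ∇_m Δ f = ∇_m ∇^j ∇_j f` and `Y = ∇^j ∇_j ∇_m f`, the contracted Bianchi identity reads
`X = 2 Y` because `∇ Ric = -∇∇∇ f`, and the Ricci identity reads `Y = X + R_lm ∇^l f`. -/
theorem pderiv_bakryEmeryLaplacian_add (hG : IsNormalAt G y) (hf : ContDiffAt ℝ ∞ f y) {γ : ℝ}
    (hsol : ∀ᶠ z in 𝓝 y, ∀ i j, ricci G i j z - γ * G z i j + hessian G f i j z = 0)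
    (m : Fin n) :
    pderiv m (fun z => bakryEmeryLaplacian G f f z + 2 * γ * f z) y = 0 := by
  have hH : ∀ i j, DifferentiableAt ℝ (hessian G f i j) y := fun i j =>
    differentiableAt_of_smooth (contDiffAt_hessian hG.smooth hG.det_ne_zero hf i j)
  have hGd : ∀ i j, DifferentiableAt ℝ (fun z => G z i j) y := fun i j =>
    differentiableAt_of_smooth (hG.smooth i j)
  have hdf := differentiableAt_of_smooth hf
  have hric : ∀ a i j, pderiv a (ricci G i j) y = -pderiv a (hessian G f i j) y := by
    intro a i j
    have hev : ricci G i j =ᶠ[𝓝 y] fun z => γ * G z i j - hessian G f i j z :=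
      hsol.mono fun z hz => by have := hz i j; simp only; linarith
    rw [pderiv_congr hev, pderiv_sub ((hGd i j).const_mul γ) (hH i j), pderiv_const_mul (hGd i j),
      hG.pderiv_eq_zero]
    ring
  have hX := hG.contracted_bianchi m
  simp only [hric, Finset.sum_neg_distrib] at hX
  have hY := hG.ricci_identity hf m
  have hR : ∑ l, ricci G l m y * pderiv l f y
      = γ * pderiv m f y - ∑ l, pderiv m (pderiv l f) y * pderiv l f y := by
    have : ∀ l, ricci G l m y * pderiv l f y
        = (if l = m then γ * pderiv l f y else 0) - pderiv m (pderiv l f) y * pderiv l f y := by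
      intro l
      have h1 := hsol.self_of_nhds l m
      have h2 : hessian G f l m y = pderiv m (pderiv l f) y := by
        rw [(pderiv_comm_eventually hf m l).self_of_nhds]
        simp [hessian, hG.christoffel_eq_zero]
      rw [h2, hG.eq_one, Matrix.one_apply] at h1
      split_ifs at h1 ⊢ with hlm
      · rw [show ricci G l m y = γ - pderiv m (pderiv l f) y by linarith]; ring
      · rw [show ricci G l m y = - pderiv m (pderiv l f) y by linarith]; ring
    simp [this]
  have hL : DifferentiableAt ℝ (laplacian G f) y := by
    refine differentiableAt_of_smooth (ContDiffAt.sum fun i _ => ContDiffAt.sum fun j _ => ?_)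
    exact (hG.contDiffAt_inv i j).mul (contDiffAt_hessian hG.smooth hG.det_ne_zero hf i j)
  have hI : DifferentiableAt ℝ (gradInner G f f) y := by
    refine differentiableAt_of_smooth (ContDiffAt.sum fun i _ => ContDiffAt.sum fun j _ => ?_)
    exact ((hG.contDiffAt_inv i j).mul (contDiffAt_pderiv hf i)).mul (contDiffAt_pderiv hf j)
  have hB : pderiv m (fun z => bakryEmeryLaplacian G f f z + 2 * γ * f z) y
      = pderiv m (laplacian G f) y - pderiv m (gradInner G f f) y + 2 * γ * pderiv m f y := by
    rw [← pderiv_const_mul hdf, ← pderiv_sub hL hI, ← pderiv_add (hL.fun_sub hI) (hdf.const_mul _)]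
    rfl
  rw [hB, hG.pderiv_laplacian hf, hG.pderiv_gradInner_self hf, ← Finset.mul_sum]
  linarith

end IsNormalAt

end NormalCoordinates

/-! ### Divergence form of the Bakry-Émery Laplacian -/

section Divergence

variable {n : ℕ} {φ u : EuclideanSpace ℝ (Fin n) → ℝ} {y : EuclideanSpace ℝ (Fin n)}
  {G : EuclideanSpace ℝ (Fin n) → Matrix (Fin n) (Fin n) ℝ}

theorem sum_comm_pairs {ι : Type*} [Fintype ι] (F : ι → ι → ι → ι → ℝ) :
    ∑ i, ∑ j, ∑ k, ∑ l, F i j k l = ∑ l, ∑ k, ∑ i, ∑ j, F i j k l := by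
  have : ∑ i, ∑ j, ∑ k, ∑ l, F i j k l = ∑ k, ∑ l, ∑ i, ∑ j, F i j k l := by
    have h1 : ∀ i j, ∑ k, ∑ l, F i j k l = ∑ q : ι × ι, F i j q.1 q.2 := fun i j =>
      (Fintype.sum_prod_type' (fun k l => F i j k l)).symm
    have h2 : ∀ k l, ∑ i, ∑ j, F i j k l = ∑ p : ι × ι, F p.1 p.2 k l := fun k l =>
      (Fintype.sum_prod_type' (fun i j => F i j k l)).symm
    simp only [h1, h2]
    rw [← Fintype.sum_prod_type' (fun i j => ∑ q : ι × ι, F i j q.1 q.2),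
      ← Fintype.sum_prod_type' (fun k l => ∑ p : ι × ι, F p.1 p.2 k l)]
    exact Finset.sum_comm
  rw [this, Finset.sum_comm]

/-- The identity `(1/√g) ∂_i (√g g^{ij}) = -g^{kl} Γ^j_kl`, contracted with the covector `v`.
Here `N` and `D` stand for `g^{ij}` and `∂_i g_jk`. -/
theorem sum_trace_sub_eq_neg_sum_christoffel (N : Fin n → Fin n → ℝ)
    (D : Fin n → Fin n → Fin n → ℝ) (v : Fin n → ℝ) (hN : ∀ i j, N i j = N j i)
    (hD : ∀ i j k, D i j k = D i k j) :
    ∑ i, ∑ j, ((1 / 2 : ℝ) * (∑ a, ∑ b, N a b * D i b a) * (N i j * v j)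
      + (-∑ a, ∑ b, N i a * D i a b * N b j) * v j)
      = -∑ i, ∑ j, N i j * ∑ k, ((1 / 2 : ℝ) * ∑ l, N k l *
        (D i j l + D j i l - D l i j)) * v k := by
  have e1 : ∑ i, ∑ j, (1 / 2 : ℝ) * (∑ a, ∑ b, N a b * D i b a) * (N i j * v j)
      = 1 / 2 * ∑ i, ∑ j, ∑ k, ∑ l, N i j * N k l * D l i j * v k := by
    rw [sum_comm_pairs]
    simp only [Finset.mul_sum, Finset.sum_mul]
    refine Finset.sum_congr rfl fun l _ => Finset.sum_congr rfl fun k _ =>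
      Finset.sum_congr rfl fun i _ => Finset.sum_congr rfl fun j _ => ?_
    rw [hN l k, hD l j i]; ring
  have e2 : ∑ i, ∑ j, (∑ a, ∑ b, N i a * D i a b * N b j) * v j
      = ∑ i, ∑ j, ∑ k, ∑ l, N i j * N k l * D i j l * v k := by
    refine Finset.sum_congr rfl fun i _ => ?_
    rw [Finset.sum_comm]
    simp only [Finset.sum_mul]
    refine Finset.sum_congr rfl fun k _ => Finset.sum_congr rfl fun j _ =>
      Finset.sum_congr rfl fun l _ => ?_
    rw [hN l k]; ring
  have e3 : ∑ i, ∑ j, ∑ k, ∑ l, N i j * N k l * D j i l * v k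
      = ∑ i, ∑ j, ∑ k, ∑ l, N i j * N k l * D i j l * v k := by
    rw [Finset.sum_comm]
    refine Finset.sum_congr rfl fun i _ => Finset.sum_congr rfl fun j _ =>
      Finset.sum_congr rfl fun k _ => Finset.sum_congr rfl fun l _ => ?_
    rw [hN j i]
  have e4 : ∑ i, ∑ j, N i j * ∑ k, ((1 / 2 : ℝ) * ∑ l, N k l *
        (D i j l + D j i l - D l i j)) * v k
      = 1 / 2 * (∑ i, ∑ j, ∑ k, ∑ l, N i j * N k l * D i j l * v k
        + ∑ i, ∑ j, ∑ k, ∑ l, N i j * N k l * D j i l * v k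
        - ∑ i, ∑ j, ∑ k, ∑ l, N i j * N k l * D l i j * v k) := by
    simp only [← Finset.sum_add_distrib, ← Finset.sum_sub_distrib, Finset.mul_sum,
      Finset.sum_mul]
    refine Finset.sum_congr rfl fun i _ => Finset.sum_congr rfl fun j _ =>
      Finset.sum_congr rfl fun k _ => Finset.sum_congr rfl fun l _ => ?_
    ring
  simp only [Finset.sum_add_distrib, neg_mul, Finset.sum_neg_distrib, e1, e2, e4, e3]
  ring

/-- The density `√(det g_ij) e^{-φ}` of the weighted measure `e^{-φ} dV_g`. -/
def weight (G : EuclideanSpace ℝ (Fin n) → Matrix (Fin n) (Fin n) ℝ)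
    (φ : EuclideanSpace ℝ (Fin n) → ℝ) (y : EuclideanSpace ℝ (Fin n)) : ℝ :=
  Real.sqrt (G y).det * Real.exp (-φ y)

theorem contDiffAt_weight (hG : ∀ i j, ContDiffAt ℝ ∞ (fun z => G z i j) y)
    (h0 : 0 < (G y).det) (hφ : ContDiffAt ℝ ∞ φ y) : ContDiffAt ℝ ∞ (weight G φ) y :=
  ((contDiffAt_det hG).sqrt h0.ne').mul hφ.neg.exp

theorem pderiv_weight (hG : ∀ i j, ContDiffAt ℝ ∞ (fun z => G z i j) y)
    (h0 : 0 < (G y).det) (hφ : ContDiffAt ℝ ∞ φ y) (i : Fin n) :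
    pderiv i (weight G φ) y = weight G φ y *
      ((1 / 2 : ℝ) * (∑ a, ∑ b, (G y)⁻¹ a b * pderiv i (fun z => G z b a) y)
        - pderiv i φ y) := by
  have hd := contDiffAt_det hG
  have h1 : pderiv i (fun z => Real.sqrt (G z).det) y
      = 1 / (2 * Real.sqrt (G y).det) * pderiv i (fun z => (G z).det) y :=
    pderiv_comp_real (Real.hasDerivAt_sqrt h0.ne') (differentiableAt_of_smooth hd) i
  have h2 : pderiv i (fun z => Real.exp (-φ z)) y = -Real.exp (-φ y) * pderiv i φ y := by
    refine pderiv_comp_real (φ := fun t => Real.exp (-t)) ?_ (differentiableAt_of_smooth hφ) i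
    simpa using (hasDerivAt_neg (φ y)).exp
  have h3 := pderiv_mul (differentiableAt_of_smooth (hd.sqrt h0.ne'))
    (differentiableAt_of_smooth hφ.neg.exp) i
  have h4 : pderiv i (weight G φ) y = _ := h3
  rw [h4, h2, h1,
    pderiv_det hG h0.ne', weight]
  have hs : Real.sqrt (G y).det ≠ 0 := (Real.sqrt_pos.2 h0).ne'
  have hsq : (G y).det = Real.sqrt (G y).det * Real.sqrt (G y).det :=
    (Real.mul_self_sqrt h0.le).symm
  generalize ∑ k, ∑ l, (G y)⁻¹ k l * pderiv i (fun z => G z l k) y = T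
  generalize hsd : Real.sqrt (G y).det = s at *
  rw [hsq]
  field_simp
  ring

/-- The component `√g e^{-φ} g^{ij} ∂_j u` of the weighted gradient of `u`. -/
def flux (G : EuclideanSpace ℝ (Fin n) → Matrix (Fin n) (Fin n) ℝ)
    (φ u : EuclideanSpace ℝ (Fin n) → ℝ) (i : Fin n) (y : EuclideanSpace ℝ (Fin n)) : ℝ :=
  weight G φ y * ∑ j, (G y)⁻¹ i j * pderiv j u y

theorem contDiffAt_flux (hG : ∀ i j, ContDiffAt ℝ ∞ (fun z => G z i j) y)
    (h0 : 0 < (G y).det) (hφ : ContDiffAt ℝ ∞ φ y) (hu : ContDiffAt ℝ ∞ u y) (i : Fin n) :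
    ContDiffAt ℝ ∞ (flux G φ u i) y :=
  (contDiffAt_weight hG h0 hφ).mul (ContDiffAt.sum fun j _ =>
    (contDiffAt_inv hG h0.ne' i j).mul (contDiffAt_pderiv hu j))

theorem contDiffAt_gradInner (hG : ∀ i j, ContDiffAt ℝ ∞ (fun z => G z i j) y)
    (h0 : (G y).det ≠ 0) (hφ : ContDiffAt ℝ ∞ φ y) (hu : ContDiffAt ℝ ∞ u y) :
    ContDiffAt ℝ ∞ (gradInner G φ u) y :=
  ContDiffAt.sum fun i _ => ContDiffAt.sum fun j _ =>
    ((contDiffAt_inv hG h0 i j).mul (contDiffAt_pderiv hφ i)).mul (contDiffAt_pderiv hu j)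

theorem contDiffAt_bakryEmeryLaplacian (hG : ∀ i j, ContDiffAt ℝ ∞ (fun z => G z i j) y)
    (h0 : (G y).det ≠ 0) (hφ : ContDiffAt ℝ ∞ φ y) (hu : ContDiffAt ℝ ∞ u y) :
    ContDiffAt ℝ ∞ (bakryEmeryLaplacian G φ u) y :=
  (ContDiffAt.sum fun i _ => ContDiffAt.sum fun j _ =>
    (contDiffAt_inv hG h0 i j).mul (contDiffAt_hessian hG h0 hu i j)).sub
  (contDiffAt_gradInner hG h0 hφ hu)

/-- The divergence form of the Bakry-Émery Laplacian,
`√g e^{-φ} Δ_φ u = ∂_i (√g e^{-φ} g^{ij} ∂_j u)`. -/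
theorem sum_pderiv_flux (hG : ∀ i j, ContDiffAt ℝ ∞ (fun z => G z i j) y)
    (hsymm : ∀ᶠ z in 𝓝 y, ∀ i j, G z i j = G z j i)
    (h0 : 0 < (G y).det) (hφ : ContDiffAt ℝ ∞ φ y) (hu : ContDiffAt ℝ ∞ u y) :
    ∑ i, pderiv i (flux G φ u i) y = weight G φ y * bakryEmeryLaplacian G φ u y := by
  have hN : ∀ i j, DifferentiableAt ℝ (fun z => (G z)⁻¹ i j) y := fun i j =>
    differentiableAt_of_smooth (contDiffAt_inv hG h0.ne' i j)
  have hu1 : ∀ j, DifferentiableAt ℝ (pderiv j u) y := fun j =>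
    differentiableAt_of_smooth (contDiffAt_pderiv hu j)
  have hNsymm : ∀ i j, (G y)⁻¹ i j = (G y)⁻¹ j i := by
    intro i j
    have : (G y).transpose = G y := by
      ext a b; exact hsymm.self_of_nhds b a
    rw [← Matrix.transpose_apply (G y)⁻¹ j i, Matrix.transpose_nonsing_inv, this]
  have hDsymm : ∀ i j k, pderiv i (fun z => G z j k) y = pderiv i (fun z => G z k j) y :=
    fun i j k => pderiv_congr (hsymm.mono fun z hz => hz j k) i
  have key := sum_trace_sub_eq_neg_sum_christoffel (fun i j => (G y)⁻¹ i j)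
    (fun i j k => pderiv i (fun z => G z j k) y) (fun j => pderiv j u y) hNsymm hDsymm
  have hX : ∀ i, pderiv i (flux G φ u i) y = weight G φ y * ∑ j,
      (((1 / 2 : ℝ) * (∑ a, ∑ b, (G y)⁻¹ a b * pderiv i (fun z => G z b a) y)
          * ((G y)⁻¹ i j * pderiv j u y)
        + (-∑ a, ∑ b, (G y)⁻¹ i a * pderiv i (fun z => G z a b) y * (G y)⁻¹ b j) * pderiv j u y)
        - (G y)⁻¹ i j * pderiv i φ y * pderiv j u y
        + (G y)⁻¹ i j * pderiv i (pderiv j u) y) := by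
    intro i
    have h1 : pderiv i (flux G φ u i) y = _ :=
      pderiv_mul (differentiableAt_of_smooth (contDiffAt_weight hG h0 hφ))
        (DifferentiableAt.fun_sum (u := Finset.univ) fun j _ => (hN i j).fun_mul (hu1 j)) i
    rw [h1, pderiv_weight hG h0 hφ, pderiv_sum Finset.univ
      (F := fun j z => (G z)⁻¹ i j * pderiv j u z) fun j _ => (hN i j).fun_mul (hu1 j)]
    simp only [fun j => pderiv_mul (hN i j) (hu1 j) i, pderiv_inv hG h0.ne']
    rw [mul_assoc, ← mul_add]
    congr 1
    rw [Finset.mul_sum, ← Finset.sum_add_distrib]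
    exact Finset.sum_congr rfl fun j _ => by ring
  simp only [hX, ← Finset.mul_sum]
  congr 1
  simp only [Finset.sum_add_distrib, Finset.sum_sub_distrib] at key ⊢
  rw [key, bakryEmeryLaplacian, laplacian, gradInner]
  simp only [hessian, christoffel, mul_sub, Finset.sum_sub_distrib]
  ring

/-- The weighted gradient of `u` pairs with the differential of `η` to the gradient product. -/
theorem sum_pderiv_mul_flux (η : EuclideanSpace ℝ (Fin n) → ℝ) :
    ∑ i, pderiv i η y * flux G φ u i y = weight G φ y * gradInner G η u y := by
  simp only [flux, gradInner, Finset.mul_sum]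
  exact Finset.sum_congr rfl fun i _ => Finset.sum_congr rfl fun j _ => by ring

end Divergence

/-! ### The metric coefficients in a chart -/

section Charts

variable {n : ℕ} {M : Type*} [TopologicalSpace M]
  [ChartedSpace (EuclideanSpace ℝ (Fin n)) M]
  {e e' : OpenPartialHomeomorph M (EuclideanSpace ℝ (Fin n))}

theorem contMDiffAt_symm_chart (he : e ∈ charts n M) {y : EuclideanSpace ℝ (Fin n)}
    (hy : y ∈ e.target) : ContMDiffAt (𝓡 n) (𝓡 n) ∞ e.symm y :=
  contMDiffAt_symm_of_mem_maximalAtlas he hy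

theorem mdifferentiableAt_symm_chart (he : e ∈ charts n M) {y : EuclideanSpace ℝ (Fin n)}
    (hy : y ∈ e.target) : MDifferentiableAt (𝓡 n) (𝓡 n) e.symm y :=
  (contMDiffAt_symm_chart he hy).mdifferentiableAt (by simp)

/-- The coordinate expression of a smooth function is smooth. -/
theorem contDiffAt_comp_symm (he : e ∈ charts n M) {u : M → ℝ}
    {y : EuclideanSpace ℝ (Fin n)} (hy : y ∈ e.target)
    (hu : ContMDiffAt (𝓡 n) 𝓘(ℝ, ℝ) ∞ u (e.symm y)) : ContDiffAt ℝ ∞ (u ∘ e.symm) y :=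
  (hu.comp y (contMDiffAt_symm_chart he hy)).contDiffAt

/-- A change of charts is smooth. -/
theorem contDiffAt_transition (he : e ∈ charts n M) (he' : e' ∈ charts n M)
    {y : EuclideanSpace ℝ (Fin n)} (hy : y ∈ e'.target) (hy' : e'.symm y ∈ e.source) :
    ContDiffAt ℝ ∞ (e ∘ e'.symm) y :=
  ((contMDiffAt_of_mem_maximalAtlas he hy').comp y (contMDiffAt_symm_chart he' hy)).contDiffAt

theorem mfderiv_symm_injective (he : e ∈ charts n M) {y : EuclideanSpace ℝ (Fin n)}
    (hy : y ∈ e.target) :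
    Function.Injective (mfderiv (𝓡 n) (𝓡 n) e.symm y) := by
  have h1 : (e ∘ e.symm) =ᶠ[𝓝 y] id :=
    (e.open_target.mem_nhds hy |> fun h => Filter.mem_of_superset h fun z hz => e.right_inv hz)
  have h2 := h1.mfderiv_eq (I := 𝓡 n) (I' := 𝓡 n)
  have he1 : MDifferentiableAt (𝓡 n) (𝓡 n) e (e.symm y) :=
    (contMDiffAt_of_mem_maximalAtlas he (e.map_target hy)).mdifferentiableAt (by simp)
  rw [mfderiv_comp y he1 (mdifferentiableAt_symm_chart he hy), mfderiv_id] at h2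
  intro v w hvw
  have h3 : ∀ v, mfderiv (𝓡 n) (𝓡 n) e (e.symm y) (mfderiv (𝓡 n) (𝓡 n) e.symm y v) = v :=
    fun v => congrArg (fun L : EuclideanSpace ℝ (Fin n) →L[ℝ] EuclideanSpace ℝ (Fin n) => L v) h2
  rw [← h3 v, ← h3 w, hvw]

variable [IsManifold (𝓡 n) ∞ M] (g : Metric n M)

theorem gram_symm (y : EuclideanSpace ℝ (Fin n)) (i j : Fin n) :
    gram g e y i j = gram g e y j i :=
  g.symm _ _ _

theorem contMDiffAt_coordVector (he : e ∈ charts n M) {y : EuclideanSpace ℝ (Fin n)}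
    (hy : y ∈ e.target) (i : Fin n) :
    ContMDiffAt (𝓡 n) ((𝓡 n).prod 𝓘(ℝ, EuclideanSpace ℝ (Fin n))) ∞
      (fun z => Bundle.TotalSpace.mk' (EuclideanSpace ℝ (Fin n))
        (E := (TangentSpace (𝓡 n) : M → Type _)) (e.symm z) (coordVector e i z)) y := by
  have hv : ContMDiffAt (𝓡 n) ((𝓡 n).prod 𝓘(ℝ, EuclideanSpace ℝ (Fin n))) ∞
      (fun z => Bundle.TotalSpace.mk' (EuclideanSpace ℝ (Fin n))
        (E := (TangentSpace (𝓡 n) : EuclideanSpace ℝ (Fin n) → Type _)) z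
        (EuclideanSpace.single i (1 : ℝ) : EuclideanSpace ℝ (Fin n))) y :=
    contMDiffAt_vectorSpace_iff_contDiffAt.2 contDiffAt_const
  exact ContMDiffAt.clm_apply_of_inCoordinates
    (ContMDiffAt.mfderiv_const (contMDiffAt_symm_chart he hy) (m := ∞) (by simp)) hv
    (contMDiffAt_symm_chart he hy)

theorem contDiffAt_gram (he : e ∈ charts n M) {y : EuclideanSpace ℝ (Fin n)}
    (hy : y ∈ e.target) (i j : Fin n) : ContDiffAt ℝ ∞ (fun z => gram g e z i j) y := by
  rw [← contMDiffAt_iff_contDiffAt]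
  have : ContMDiffAt (𝓡 n) ((𝓡 n).prod 𝓘(ℝ, ℝ)) ∞
      (fun z => Bundle.TotalSpace.mk' ℝ (E := Bundle.Trivial M ℝ) (e.symm z)
        (g.inner (e.symm z) (coordVector e i z) (coordVector e j z))) y := by
    apply ContMDiffAt.clm_bundle_apply₂ (F₁ := EuclideanSpace ℝ (Fin n))
      (F₂ := EuclideanSpace ℝ (Fin n))
    · exact (g.contMDiff.contMDiffAt).comp y (contMDiffAt_symm_chart he hy)
    · exact contMDiffAt_coordVector he hy i
    · exact contMDiffAt_coordVector he hy j
  rw [Bundle.contMDiffAt_totalSpace] at this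
  exact this.2

/-- The Jacobian matrix of `φ` at `y`. -/
def jacobian (φ : EuclideanSpace ℝ (Fin n) → EuclideanSpace ℝ (Fin n))
    (y : EuclideanSpace ℝ (Fin n)) : Matrix (Fin n) (Fin n) ℝ :=
  Matrix.of fun k i => fderiv ℝ φ y (EuclideanSpace.single i 1) k

/-- The metric on tangent vectors that are given by their components in a chart. -/
theorem gram_apply_eq (y : EuclideanSpace ℝ (Fin n)) (v w : EuclideanSpace ℝ (Fin n)) :
    (g.inner (e.symm y) (mfderiv (𝓡 n) (𝓡 n) e.symm y v)) (mfderiv (𝓡 n) (𝓡 n) e.symm y w)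
      = ∑ k, ∑ l, v k * gram g e y k l * w l := by
  have hv : ∀ v : EuclideanSpace ℝ (Fin n), v = ∑ i, v i • EuclideanSpace.single i (1 : ℝ) :=
    fun v => by simpa using ((EuclideanSpace.basisFun (Fin n) ℝ).sum_repr v).symm
  have h1 : ∀ v : EuclideanSpace ℝ (Fin n), mfderiv (𝓡 n) (𝓡 n) e.symm y v
      = ∑ i, v i • coordVector e i y := by
    intro v
    conv_lhs => rw [hv v]
    erw [map_sum]
    refine Finset.sum_congr rfl fun i _ => ?_
    erw [map_smul]
    rfl
  rw [h1 v, h1 w]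
  simp only [map_sum, map_smul, sum_apply, smul_apply]
  simp only [smul_eq_mul, Finset.mul_sum]
  rw [Finset.sum_comm]
  refine Finset.sum_congr rfl fun k _ => Finset.sum_congr rfl fun l _ => ?_
  simp only [gram, Matrix.of_apply]
  ring

/-- The transformation law of the metric coefficients under a change of coordinates `φ`. -/
theorem gram_eq_of_eventuallyEq (he : e ∈ charts n M)
    {φ : EuclideanSpace ℝ (Fin n) → EuclideanSpace ℝ (Fin n)} {z : EuclideanSpace ℝ (Fin n)}
    (hφ : DifferentiableAt ℝ φ z) (hz : φ z ∈ e.target)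
    (heq : e'.symm =ᶠ[𝓝 z] e.symm ∘ φ) :
    gram g e' z = (jacobian φ z).transpose * gram g e (φ z) * jacobian φ z := by
  have hp : e'.symm z = e.symm (φ z) := heq.self_of_nhds
  have hd : ∀ i, (coordVector e' i z : EuclideanSpace ℝ (Fin n))
      = mfderiv (𝓡 n) (𝓡 n) e.symm (φ z) (fderiv ℝ φ z (EuclideanSpace.single i 1)) := by
    intro i
    have h1 := heq.mfderiv_eq (I := 𝓡 n) (I' := 𝓡 n)
    have h2 := mfderiv_comp z (mdifferentiableAt_symm_chart he hz) hφ.mdifferentiableAt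
    rw [mfderiv_eq_fderiv] at h2
    have h3 := h1.trans h2
    exact congrArg (fun L : EuclideanSpace ℝ (Fin n) →L[ℝ] EuclideanSpace ℝ (Fin n) =>
      L (EuclideanSpace.single i 1)) h3
  ext i j
  have h4 : gram g e' z i j = g.inner (e.symm (φ z))
      (mfderiv (𝓡 n) (𝓡 n) e.symm (φ z) (fderiv ℝ φ z (EuclideanSpace.single i 1)))
      (mfderiv (𝓡 n) (𝓡 n) e.symm (φ z) (fderiv ℝ φ z (EuclideanSpace.single j 1))) := by
    rw [← hd i, ← hd j, ← hp]
    rfl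
  rw [h4, gram_apply_eq]
  simp only [Matrix.mul_apply, Matrix.transpose_apply, jacobian, Matrix.of_apply, Finset.sum_mul]
  rw [Finset.sum_comm]

theorem posDef_gram (he : e ∈ charts n M) {y : EuclideanSpace ℝ (Fin n)}
    (hy : y ∈ e.target) : (gram g e y).PosDef := by
  refine Matrix.PosDef.of_dotProduct_mulVec_pos ?_ fun v hv => ?_
  · ext i j
    simpa using gram_symm g y j i
  · have hv' : (WithLp.toLp 2 v : EuclideanSpace ℝ (Fin n)) ≠ 0 := by simpa using hv
    have h1 := g.pos (e.symm y)
      (mfderiv (𝓡 n) (𝓡 n) e.symm y (WithLp.toLp 2 v : EuclideanSpace ℝ (Fin n)))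
      (fun h0 => hv' (mfderiv_symm_injective he hy (h0.trans (map_zero _).symm)))
    rw [gram_apply_eq] at h1
    simpa [dotProduct, Matrix.mulVec, Finset.mul_sum, mul_assoc] using h1

theorem det_gram_pos (he : e ∈ charts n M) {y : EuclideanSpace ℝ (Fin n)}
    (hy : y ∈ e.target) : 0 < (gram g e y).det :=
  (posDef_gram g he hy).det_pos

theorem eventually_gram_symm (y : EuclideanSpace ℝ (Fin n)) :
    ∀ᶠ z in 𝓝 y, ∀ i j, gram g e z i j = gram g e z j i :=
  Filter.Eventually.of_forall fun z i j => gram_symm g z i j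

end Charts

/-! ### Change of charts -/

theorem symm_eventuallyEq_comp_transition {M H : Type*} [TopologicalSpace M] [TopologicalSpace H]
    {e e' : OpenPartialHomeomorph M H} {z : H} (hz : z ∈ e'.target)
    (hz' : e'.symm z ∈ e.source) : e'.symm =ᶠ[𝓝 z] e.symm ∘ (e ∘ e'.symm) := by
  have : e'.symm ⁻¹' e.source ∈ 𝓝 z :=
    (e'.symm.continuousAt hz).preimage_mem_nhds (e.open_source.mem_nhds hz')
  filter_upwards [this] with w hw
  exact (e.left_inv hw).symm

section ChangeOfCharts

variable {n : ℕ} {M : Type*} [TopologicalSpace M]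
  [ChartedSpace (EuclideanSpace ℝ (Fin n)) M] [IsManifold (𝓡 n) ∞ M]
  {e e' : OpenPartialHomeomorph M (EuclideanSpace ℝ (Fin n))} (g : Metric n M)

theorem gram_eq_of_mem (he : e ∈ charts n M) (he' : e' ∈ charts n M)
    {z : EuclideanSpace ℝ (Fin n)} (hz : z ∈ e'.target) (hz' : e'.symm z ∈ e.source) :
    gram g e' z = (jacobian (e ∘ e'.symm) z).transpose * gram g e (e (e'.symm z))
      * jacobian (e ∘ e'.symm) z :=
  gram_eq_of_eventuallyEq g he
    ((contDiffAt_transition he he' hz hz').differentiableAt (by simp)) (e.map_source hz')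
    (symm_eventuallyEq_comp_transition hz hz')

theorem det_gram_eq_of_mem (he : e ∈ charts n M) (he' : e' ∈ charts n M)
    {z : EuclideanSpace ℝ (Fin n)} (hz : z ∈ e'.target) (hz' : e'.symm z ∈ e.source) :
    (gram g e' z).det = (jacobian (e ∘ e'.symm) z).det ^ 2 * (gram g e (e (e'.symm z))).det := by
  rw [gram_eq_of_mem g he he' hz hz', Matrix.det_mul, Matrix.det_mul, Matrix.det_transpose]
  ring

theorem gradInner_eq_dotProduct (G : EuclideanSpace ℝ (Fin n) → Matrix (Fin n) (Fin n) ℝ)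
    (a b : EuclideanSpace ℝ (Fin n) → ℝ) (y : EuclideanSpace ℝ (Fin n)) :
    gradInner G a b y = (fun i => pderiv i a y) ⬝ᵥ (G y)⁻¹.mulVec (fun j => pderiv j b y) := by
  simp only [gradInner, dotProduct, Matrix.mulVec, Finset.mul_sum]
  exact Finset.sum_congr rfl fun i _ => Finset.sum_congr rfl fun j _ => by ring

theorem pderiv_comp {φ : EuclideanSpace ℝ (Fin n) → EuclideanSpace ℝ (Fin n)}
    {a : EuclideanSpace ℝ (Fin n) → ℝ} {z : EuclideanSpace ℝ (Fin n)}
    (hφ : DifferentiableAt ℝ φ z) (ha : DifferentiableAt ℝ a (φ z)) (i : Fin n) :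
    pderiv i (a ∘ φ) z = ∑ k, jacobian φ z k i * pderiv k a (φ z) := by
  rw [pderiv, fderiv_comp z ha hφ, ContinuousLinearMap.comp_apply, fderiv_apply_eq_sum_pderiv]
  rfl

/-- The inner product of the gradients of two functions does not depend on the chart. -/
theorem gradInner_eq_of_mem (he : e ∈ charts n M) (he' : e' ∈ charts n M) {a b : M → ℝ}
    (ha : ContMDiff (𝓡 n) 𝓘(ℝ, ℝ) ∞ a) (hb : ContMDiff (𝓡 n) 𝓘(ℝ, ℝ) ∞ b)
    {p : M} (hp : p ∈ e.source) (hp' : p ∈ e'.source) :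
    gradInner (gram g e') (a ∘ e'.symm) (b ∘ e'.symm) (e' p)
      = gradInner (gram g e) (a ∘ e.symm) (b ∘ e.symm) (e p) := by
  have hz : e' p ∈ e'.target := e'.map_source hp'
  have hzp : e'.symm (e' p) = p := e'.left_inv hp'
  have hz' : e'.symm (e' p) ∈ e.source := by rwa [hzp]
  have hτ : DifferentiableAt ℝ (e ∘ e'.symm) (e' p) :=
    (contDiffAt_transition he he' hz hz').differentiableAt (by simp)
  have hτp : (e ∘ e'.symm) (e' p) = e p := by simp [hzp]
  set J := jacobian (e ∘ e'.symm) (e' p) with hJ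
  have key : ∀ {c : M → ℝ}, ContMDiff (𝓡 n) 𝓘(ℝ, ℝ) ∞ c →
      (fun i => pderiv i (c ∘ e'.symm) (e' p))
        = J.transpose.mulVec (fun k => pderiv k (c ∘ e.symm) (e p)) := by
    intro c hc
    funext i
    have hev : c ∘ e'.symm =ᶠ[𝓝 (e' p)] (c ∘ e.symm) ∘ (e ∘ e'.symm) :=
      (symm_eventuallyEq_comp_transition hz hz').fun_comp c
    have hd : DifferentiableAt ℝ (c ∘ e.symm) ((e ∘ e'.symm) (e' p)) := by
      rw [hτp]
      exact differentiableAt_of_smooth (contDiffAt_comp_symm he (e.map_source hp) hc.contMDiffAt)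
    rw [pderiv_congr hev, pderiv_comp hτ hd, hτp]
    rfl
  have hG := gram_eq_of_mem g he he' hz hz'
  rw [hzp] at hG
  have hdet : (gram g e' (e' p)).det ≠ 0 := (det_gram_pos g he' hz).ne'
  have hJdet : IsUnit J.det := by
    rw [isUnit_iff_ne_zero]
    intro h0
    apply hdet
    rw [hG, Matrix.det_mul, ← hJ, h0, mul_zero]
  have hJT : IsUnit J.transpose.det := by rwa [Matrix.det_transpose]
  rw [gradInner_eq_dotProduct, gradInner_eq_dotProduct, key ha, key hb, hG, ← hJ,
    Matrix.mul_inv_rev, Matrix.mul_inv_rev, Matrix.mulVec_mulVec,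
    Matrix.mulVec_transpose J (fun k => pderiv k (a ∘ e.symm) (e p)), ← Matrix.dotProduct_mulVec,
    Matrix.mulVec_mulVec]
  congr 2
  rw [Matrix.mul_assoc, Matrix.mul_assoc, Matrix.nonsing_inv_mul _ hJT, Matrix.mul_one,
    ← Matrix.mul_assoc, Matrix.mul_nonsing_inv _ hJdet, Matrix.one_mul]

end ChangeOfCharts

section NormalCharts

variable {n : ℕ} {M : Type*} [TopologicalSpace M]
  [ChartedSpace (EuclideanSpace ℝ (Fin n)) M] [IsManifold (𝓡 n) ∞ M]
  {e : OpenPartialHomeomorph M (EuclideanSpace ℝ (Fin n))} (g : Metric n M)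

/-- A smooth map with invertible differential at `z` is locally a change of coordinates. -/
theorem exists_chart_symm_eventuallyEq (he : e ∈ charts n M)
    {φ : EuclideanSpace ℝ (Fin n) → EuclideanSpace ℝ (Fin n)} {z : EuclideanSpace ℝ (Fin n)}
    (hφ : ContDiff ℝ ∞ φ) (hz : φ z ∈ e.target)
    (L : EuclideanSpace ℝ (Fin n) ≃L[ℝ] EuclideanSpace ℝ (Fin n))
    (hL : HasFDerivAt φ (L : EuclideanSpace ℝ (Fin n) →L[ℝ] EuclideanSpace ℝ (Fin n)) z) :
    ∃ e' ∈ charts n M, z ∈ e'.target ∧ e'.symm =ᶠ[𝓝 z] e.symm ∘ φ := by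
  set ψ := hφ.contDiffAt.toOpenPartialHomeomorph φ hL (n := ∞) (by simp) with hψ
  have hzψ : z ∈ ψ.source := hφ.contDiffAt.mem_toOpenPartialHomeomorph_source hL (by simp)
  -- The points at which the differential of `φ` is invertible.
  set V : Set (EuclideanSpace ℝ (Fin n)) := fderiv ℝ φ ⁻¹' Set.range
    ((↑) : (EuclideanSpace ℝ (Fin n) ≃L[ℝ] EuclideanSpace ℝ (Fin n)) →
      EuclideanSpace ℝ (Fin n) →L[ℝ] EuclideanSpace ℝ (Fin n)) with hV
  have hVo : IsOpen V := ContinuousLinearEquiv.isOpen.preimage (hφ.continuous_fderiv (by simp))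
  have hzV : z ∈ V := ⟨L, hL.fderiv.symm⟩
  set χ := ψ.restrOpen V hVo with hχ
  have hχs : χ.source = ψ.source ∩ V := rfl
  have hχφ : ∀ w, χ w = φ w := fun _ => rfl
  have hsymm : ∀ y ∈ χ.target, ContDiffAt ℝ ∞ χ.symm y := by
    intro y hy
    have h1 : χ.symm y ∈ ψ.source ∩ V := χ.map_target hy
    obtain ⟨L', hL'⟩ := h1.2
    refine χ.contDiffAt_symm (f₀' := L') hy ?_ hφ.contDiffAt
    rw [hL']
    exact (hφ.differentiable (by simp) _).hasFDerivAt
  refine ⟨e.trans χ.symm, ?_, ?_, ?_⟩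
  · refine OpenPartialHomeomorph.mem_maximalAtlas_of_contMDiffOn _ ?_ ?_
    · intro p hp
      have hp' : p ∈ e.source ∧ e p ∈ χ.target := by simpa using hp
      refine ContMDiffAt.contMDiffWithinAt ?_
      exact (hsymm _ hp'.2).contMDiffAt.comp p (contMDiffAt_of_mem_maximalAtlas he hp'.1)
    · intro w hw
      have hw' : w ∈ χ.source ∧ χ w ∈ e.target := by simpa using hw
      refine ContMDiffAt.contMDiffWithinAt ?_
      exact (contMDiffAt_symm_chart he hw'.2).comp w hφ.contMDiff.contMDiffAt
  · have : z ∈ χ.source ∧ χ z ∈ e.target := ⟨⟨hzψ, hzV⟩, hz⟩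
    simpa using this
  · exact Filter.EventuallyEq.rfl

theorem hasFDerivAt_toContinuousLinearEquiv_jacobian
    {φ : EuclideanSpace ℝ (Fin n) → EuclideanSpace ℝ (Fin n)} {z : EuclideanSpace ℝ (Fin n)}
    (hφ : DifferentiableAt ℝ φ z) (hdet : (fderiv ℝ φ z).det ≠ 0) :
    HasFDerivAt φ (((fderiv ℝ φ z).toContinuousLinearEquivOfDetNeZero hdet :
      EuclideanSpace ℝ (Fin n) ≃L[ℝ] EuclideanSpace ℝ (Fin n)) :
      EuclideanSpace ℝ (Fin n) →L[ℝ] EuclideanSpace ℝ (Fin n)) z := by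
  simpa using hφ.hasFDerivAt

theorem det_fderiv_eq_det_jacobian (φ : EuclideanSpace ℝ (Fin n) → EuclideanSpace ℝ (Fin n))
    (z : EuclideanSpace ℝ (Fin n)) : (fderiv ℝ φ z).det = (jacobian φ z).det := by
  have h := LinearMap.det_toMatrix (EuclideanSpace.basisFun (Fin n) ℝ).toBasis
    (fderiv ℝ φ z : EuclideanSpace ℝ (Fin n) →ₗ[ℝ] EuclideanSpace ℝ (Fin n))
  rw [ContinuousLinearMap.det, ← h]
  congr 1

theorem jacobian_apply {φ : EuclideanSpace ℝ (Fin n) → EuclideanSpace ℝ (Fin n)}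
    {z : EuclideanSpace ℝ (Fin n)} (hφ : DifferentiableAt ℝ φ z) (k i : Fin n) :
    jacobian φ z k i = pderiv i (fun w => φ w k) z := by
  have h1 := ((EuclideanSpace.proj (𝕜 := ℝ) k).hasFDerivAt.comp z hφ.hasFDerivAt).fderiv
  have h2 : (fun w => φ w k) = (EuclideanSpace.proj (𝕜 := ℝ) k) ∘ φ := rfl
  rw [pderiv, h2, h1]
  rfl

open scoped MatrixOrder in
theorem exists_transpose_mul_mul_eq_one {A : Matrix (Fin n) (Fin n) ℝ} (hA : A.PosDef) :
    ∃ P : Matrix (Fin n) (Fin n) ℝ, P.transpose * A * P = 1 := by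
  obtain ⟨B, hB⟩ := CStarAlgebra.nonneg_iff_eq_star_mul_self.mp hA.posSemidef.nonneg
  have hB' : A = B.transpose * B := by
    rw [hB, Matrix.star_eq_conjTranspose, Matrix.conjTranspose_eq_transpose_of_trivial]
  have hdet : IsUnit B.det := by
    rw [isUnit_iff_ne_zero]
    intro h0
    have := hA.det_pos
    rw [hB', Matrix.det_mul, h0, mul_zero] at this
    exact lt_irrefl _ this
  refine ⟨B⁻¹, ?_⟩
  rw [hB', Matrix.mul_assoc, Matrix.mul_assoc, Matrix.mul_nonsing_inv _ hdet, Matrix.mul_one,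
    ← Matrix.transpose_mul, Matrix.mul_nonsing_inv _ hdet, Matrix.transpose_one]

/-- An affine change of coordinates makes the metric Euclidean at a given point. -/
theorem exists_chart_gram_eq_one (p : M) :
    ∃ e ∈ charts n M, (0 : EuclideanSpace ℝ (Fin n)) ∈ e.target ∧ e.symm 0 = p ∧
      gram g e 0 = 1 := by
  set e := chartAt (EuclideanSpace ℝ (Fin n)) p with he_def
  have he : e ∈ charts n M := IsManifold.chart_mem_maximalAtlas p
  have hp : p ∈ e.source := mem_chart_source _ p
  obtain ⟨P, hP⟩ := exists_transpose_mul_mul_eq_one (posDef_gram g he (e.map_source hp))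
  set L := Matrix.toEuclideanCLM (𝕜 := ℝ) P with hLdef
  set φ : EuclideanSpace ℝ (Fin n) → EuclideanSpace ℝ (Fin n) := fun z => e p + L z with hφ
  have hφs : ContDiff ℝ ∞ φ := contDiff_const.add L.contDiff
  have hφ0 : φ 0 = e p := by simp [hφ]
  have hd : fderiv ℝ φ 0 = L := by simp [hφ]
  have hJ : jacobian φ 0 = P := by
    ext k i
    simp [jacobian, hd, hLdef, Matrix.ofLp_toEuclideanCLM]
  have hdet : (fderiv ℝ φ 0).det ≠ 0 := by
    rw [det_fderiv_eq_det_jacobian, hJ]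
    intro h0
    have := congrArg Matrix.det hP
    rw [Matrix.det_mul, h0, mul_zero, Matrix.det_one] at this
    exact zero_ne_one this
  have hφd : DifferentiableAt ℝ φ 0 := hφs.differentiable (by simp) _
  obtain ⟨e', he', h0, heq⟩ := exists_chart_symm_eventuallyEq (z := 0) he hφs
    (by rw [hφ0]; exact e.map_source hp) _ (hasFDerivAt_toContinuousLinearEquiv_jacobian hφd hdet)
  refine ⟨e', he', h0, ?_, ?_⟩
  · rw [heq.self_of_nhds, Function.comp_apply, hφ0, e.left_inv hp]
  · rw [gram_eq_of_eventuallyEq g he hφd (by rw [hφ0]; exact e.map_source hp) heq, hJ, hφ0, hP]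

theorem pderiv_coord (i k : Fin n) (y : EuclideanSpace ℝ (Fin n)) :
    pderiv i (fun z : EuclideanSpace ℝ (Fin n) => z k) y = if k = i then 1 else 0 := by
  have h1 := (EuclideanSpace.proj (𝕜 := ℝ) (ι := Fin n) k).hasFDerivAt (x := y)
  have h2 : (fun z : EuclideanSpace ℝ (Fin n) => z k)
    = EuclideanSpace.proj (𝕜 := ℝ) (ι := Fin n) k := rfl
  rw [pderiv, h2, h1.fderiv]
  simp

end NormalCharts

/-! ### Normal charts -/

section QuadraticChange

variable {n : ℕ}

theorem differentiableAt_coord (k : Fin n) (y : EuclideanSpace ℝ (Fin n)) :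
    DifferentiableAt ℝ (fun z : EuclideanSpace ℝ (Fin n) => z k) y :=
  (EuclideanSpace.proj (𝕜 := ℝ) k).differentiableAt

/-- The map `z^k ↦ z^k - ½ S^k_ij z^i z^j`. If `S` is the Christoffel symbol at the origin, this
is the change to coordinates in which the Christoffel symbols vanish there. -/
def quadraticChange (S : Fin n → Fin n → Fin n → ℝ) (z : EuclideanSpace ℝ (Fin n)) :
    EuclideanSpace ℝ (Fin n) :=
  WithLp.toLp 2 fun k => z k - (1 / 2 : ℝ) * ∑ i, ∑ j, S k i j * (z i * z j)

variable (S : Fin n → Fin n → Fin n → ℝ)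

theorem contDiff_quadraticChange : ContDiff ℝ ∞ (quadraticChange S) := by
  have hc : ∀ k, ContDiff ℝ ∞ (fun z : EuclideanSpace ℝ (Fin n) => z k) := fun k =>
    (EuclideanSpace.proj (𝕜 := ℝ) k).contDiff
  refine contDiff_euclidean.2 fun k => (hc k).sub (contDiff_const.mul ?_)
  exact ContDiff.sum fun i _ => ContDiff.sum fun j _ => contDiff_const.mul ((hc i).mul (hc j))

theorem quadraticChange_zero : quadraticChange S 0 = 0 := by
  ext k
  simp [quadraticChange]

theorem jacobian_quadraticChange (hS : ∀ k i j, S k i j = S k j i)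
    (z : EuclideanSpace ℝ (Fin n)) (k b : Fin n) :
    jacobian (quadraticChange S) z k b = (if k = b then 1 else 0) - ∑ j, S k b j * z j := by
  have hd := differentiableAt_coord (n := n)
  have hp : ∀ i j, DifferentiableAt ℝ (fun z : EuclideanSpace ℝ (Fin n) => S k i j * (z i * z j)) z :=
    fun i j => ((hd i z).fun_mul (hd j z)).const_mul _
  have hp' : ∀ i, DifferentiableAt ℝ
      (fun z : EuclideanSpace ℝ (Fin n) => ∑ j, S k i j * (z i * z j)) z :=
    fun i => DifferentiableAt.fun_sum fun j _ => hp i j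
  have hs : DifferentiableAt ℝ
      (fun z : EuclideanSpace ℝ (Fin n) => ∑ i, ∑ j, S k i j * (z i * z j)) z :=
    DifferentiableAt.fun_sum fun i _ => hp' i
  have h1 : pderiv b (fun z : EuclideanSpace ℝ (Fin n) => ∑ i, ∑ j, S k i j * (z i * z j)) z
      = ∑ i, ∑ j, S k i j * ((if i = b then 1 else 0) * z j + z i * (if j = b then 1 else 0)) := by
    rw [pderiv_sum Finset.univ
      (F := fun i (z : EuclideanSpace ℝ (Fin n)) => ∑ j, S k i j * (z i * z j))
      (fun i _ => hp' i)]
    refine Finset.sum_congr rfl fun i _ => ?_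
    rw [pderiv_sum Finset.univ
      (F := fun j (z : EuclideanSpace ℝ (Fin n)) => S k i j * (z i * z j)) (fun j _ => hp i j)]
    refine Finset.sum_congr rfl fun j _ => ?_
    rw [pderiv_const_mul ((hd i z).fun_mul (hd j z)), pderiv_mul (hd i z) (hd j z), pderiv_coord,
      pderiv_coord]
  have h2 : ∑ i, ∑ j, S k i j * ((if i = b then 1 else 0) * z j + z i * (if j = b then 1 else 0))
      = 2 * ∑ j, S k b j * z j := by
    simp only [mul_add, Finset.sum_add_distrib, ite_mul, mul_ite, one_mul, mul_one, zero_mul,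
      mul_zero, Finset.sum_ite_eq', Finset.mem_univ, if_true]
    rw [Finset.sum_comm]
    simp only [Finset.sum_ite_eq', Finset.mem_univ, if_true, fun i => hS k i b]
    ring
  rw [jacobian_apply ((contDiff_quadraticChange S).differentiable (by simp) z)]
  have h3 : pderiv b (fun z => quadraticChange S z k) z
      = pderiv b (fun z : EuclideanSpace ℝ (Fin n) => z k) z
        - pderiv b (fun z : EuclideanSpace ℝ (Fin n) =>
          (1 / 2 : ℝ) * ∑ i, ∑ j, S k i j * (z i * z j)) z :=
    pderiv_sub (hd k z) (hs.const_mul _) b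
  rw [h3, pderiv_const_mul hs, h1, h2, pderiv_coord]
  ring

theorem jacobian_quadraticChange_zero (hS : ∀ k i j, S k i j = S k j i) :
    jacobian (quadraticChange S) 0 = 1 := by
  ext k b
  simp [jacobian_quadraticChange S hS, Matrix.one_apply]

theorem differentiableAt_jacobian_quadraticChange (hS : ∀ k i j, S k i j = S k j i)
    (z : EuclideanSpace ℝ (Fin n)) (k b : Fin n) :
    DifferentiableAt ℝ (fun z => jacobian (quadraticChange S) z k b) z := by
  simp only [jacobian_quadraticChange S hS]
  exact (differentiableAt_const _).fun_sub (DifferentiableAt.fun_sum fun j _ =>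
    (differentiableAt_coord j z).const_mul _)

theorem pderiv_jacobian_quadraticChange (hS : ∀ k i j, S k i j = S k j i)
    (z : EuclideanSpace ℝ (Fin n)) (a k b : Fin n) :
    pderiv a (fun z => jacobian (quadraticChange S) z k b) z = -S k b a := by
  simp only [jacobian_quadraticChange S hS]
  have hp : ∀ j, DifferentiableAt ℝ (fun z : EuclideanSpace ℝ (Fin n) => S k b j * z j) z :=
    fun j => (differentiableAt_coord j z).const_mul _
  rw [pderiv_sub (differentiableAt_const _) (DifferentiableAt.fun_sum fun j _ => hp j),
    pderiv_const, pderiv_sum Finset.univ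
      (F := fun j (z : EuclideanSpace ℝ (Fin n)) => S k b j * z j) (fun j _ => hp j)]
  simp [fun j => pderiv_const_mul (differentiableAt_coord j z) (S k b j) a, pderiv_coord]

/-- In the coordinates given by `quadraticChange` of the Christoffel symbols, the first
derivatives of the metric vanish at the origin. -/
theorem pderiv_gram_quadraticChange {G : EuclideanSpace ℝ (Fin n) → Matrix (Fin n) (Fin n) ℝ}
    (hG : ∀ i j, ContDiffAt ℝ ∞ (fun z => G z i j) 0)
    (hsymm : ∀ z i j, G z i j = G z j i) (h1 : G 0 = 1)
    (hS : ∀ k i j, S k i j = christoffelFirst G k i j 0) (a b c : Fin n) :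
    pderiv a (fun z => ((jacobian (quadraticChange S) z).transpose * G (quadraticChange S z)
      * jacobian (quadraticChange S) z) b c) 0 = 0 := by
  have hGs : ∀ i j, (fun z => G z i j) = fun z => G z j i := fun i j => funext fun z => hsymm z i j
  have hSs : ∀ k i j, S k i j = S k j i := by
    intro k i j
    rw [hS, hS, christoffelFirst, christoffelFirst, hGs j i]
    ring
  have hJ := fun k b => differentiableAt_jacobian_quadraticChange S hSs 0 k b
  have hφ : DifferentiableAt ℝ (quadraticChange S) 0 :=
    (contDiff_quadraticChange S).differentiable (by simp) 0
  have hGd : ∀ i j, DifferentiableAt ℝ (fun z => G z i j) (quadraticChange S 0) := fun i j => by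
    rw [quadraticChange_zero]; exact differentiableAt_of_smooth (hG i j)
  have hGφ : ∀ i j, DifferentiableAt ℝ (fun z => G (quadraticChange S z) i j) 0 := fun i j =>
    (hGd i j).comp (0 : EuclideanSpace ℝ (Fin n)) hφ
  have hdG : ∀ i j, pderiv a (fun z => G (quadraticChange S z) i j) 0
      = pderiv a (fun z => G z i j) 0 := by
    intro i j
    have := pderiv_comp hφ (hGd i j) a
    rw [jacobian_quadraticChange_zero S hSs, quadraticChange_zero] at this
    simp only [Matrix.one_apply, ite_mul, one_mul, zero_mul, Finset.sum_ite_eq', Finset.mem_univ,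
      if_true] at this
    exact this
  have hterm : ∀ k l, DifferentiableAt ℝ (fun z => jacobian (quadraticChange S) z k b
      * G (quadraticChange S z) k l) 0 := fun k l => (hJ k b).fun_mul (hGφ k l)
  have hsum : ∀ l, DifferentiableAt ℝ (fun z => ∑ k, jacobian (quadraticChange S) z k b
      * G (quadraticChange S z) k l) 0 := fun l => DifferentiableAt.fun_sum fun k _ => hterm k l
  simp only [Matrix.mul_apply, Matrix.transpose_apply]
  rw [pderiv_sum Finset.univ (F := fun l z => (∑ k, jacobian (quadraticChange S) z k b
      * G (quadraticChange S z) k l) * jacobian (quadraticChange S) z l c)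
      (fun l _ => (hsum l).fun_mul (hJ l c))]
  have hl : ∀ l, pderiv a (fun z => (∑ k, jacobian (quadraticChange S) z k b
      * G (quadraticChange S z) k l) * jacobian (quadraticChange S) z l c) 0
      = (-S l b a + pderiv a (fun z => G z b l) 0) * (if l = c then 1 else 0)
        + (if l = b then 1 else 0) * (-S l c a) := by
    intro l
    rw [pderiv_mul (hsum l) (hJ l c), pderiv_sum Finset.univ
      (F := fun k z => jacobian (quadraticChange S) z k b * G (quadraticChange S z) k l)
      (fun k _ => hterm k l)]
    simp only [fun k => pderiv_mul (hJ k b) (hGφ k l) a, hdG,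
      pderiv_jacobian_quadraticChange S hSs, jacobian_quadraticChange_zero S hSs,
      quadraticChange_zero, h1, Matrix.one_apply]
    simp [Finset.sum_add_distrib]
  simp only [hl, Finset.sum_add_distrib]
  simp only [mul_ite, mul_one, mul_zero, ite_mul, one_mul, zero_mul, Finset.sum_ite_eq',
    Finset.mem_univ, if_true]
  simp only [hS, christoffelFirst]
  rw [hGs a b, hGs a c, hGs c b]
  ring

end QuadraticChange

section NormalCharts

variable {n : ℕ} {M : Type*} [TopologicalSpace M]
  [ChartedSpace (EuclideanSpace ℝ (Fin n)) M] [IsManifold (𝓡 n) ∞ M] (g : Metric n M)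

/-- Every point is the origin of a chart that is normal to first order there. -/
theorem exists_normal_chart (p : M) :
    ∃ e ∈ charts n M, (0 : EuclideanSpace ℝ (Fin n)) ∈ e.target ∧ e.symm 0 = p ∧
      IsNormalAt (gram g e) 0 := by
  obtain ⟨e, he, h0, hp, h1⟩ := exists_chart_gram_eq_one g p
  set S : Fin n → Fin n → Fin n → ℝ := fun k i j => christoffelFirst (gram g e) k i j 0 with hS
  have hGs : ∀ i j, (fun z => gram g e z i j) = fun z => gram g e z j i := fun i j =>
    funext fun z => gram_symm g z i j
  have hSs : ∀ k i j, S k i j = S k j i := by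
    intro k i j
    simp only [hS, christoffelFirst]
    rw [hGs j i]
    ring
  have hφ := contDiff_quadraticChange S
  have hφd : Differentiable ℝ (quadraticChange S) := hφ.differentiable (by simp)
  have hdet : (fderiv ℝ (quadraticChange S) 0).det ≠ 0 := by
    rw [det_fderiv_eq_det_jacobian, jacobian_quadraticChange_zero S hSs]
    simp
  have hφ0 : quadraticChange S 0 ∈ e.target := by rwa [quadraticChange_zero]
  obtain ⟨e', he', h0', heq⟩ := exists_chart_symm_eventuallyEq (z := 0) he hφ hφ0 _
    (hasFDerivAt_toContinuousLinearEquiv_jacobian (hφd 0) hdet)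
  have hgram : ∀ᶠ z in 𝓝 (0 : EuclideanSpace ℝ (Fin n)), gram g e' z
      = (jacobian (quadraticChange S) z).transpose * gram g e (quadraticChange S z)
        * jacobian (quadraticChange S) z := by
    filter_upwards [heq.eventuallyEq_nhds,
      hφ.continuous.continuousAt.preimage_mem_nhds (e.open_target.mem_nhds hφ0)] with z hz hz'
    exact gram_eq_of_eventuallyEq g he (hφd z) hz' hz
  refine ⟨e', he', h0', ?_, ?_⟩
  · rw [heq.self_of_nhds, Function.comp_apply, quadraticChange_zero, hp]
  · refine ⟨contDiffAt_gram g he' h0', eventually_gram_symm g 0, ?_, fun a i j => ?_⟩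
    · rw [hgram.self_of_nhds, jacobian_quadraticChange_zero S hSs, quadraticChange_zero, h1]
      simp
    · rw [pderiv_congr (hgram.mono fun z hz => congrFun (congrFun hz i) j)]
      exact pderiv_gram_quadraticChange S (contDiffAt_gram g he h0) (gram_symm g) h1
        (fun _ _ _ => rfl) a i j

end NormalCharts

/-! ### The Riemannian volume -/

section Volume

open MeasureTheory

/-- A partial homeomorphism pulls measurable sets back to measurable sets. -/
theorem measurableSet_preimage_inter_target {X Y : Type*} [TopologicalSpace X] [TopologicalSpace Y]
    [MeasurableSpace X] [BorelSpace X] [MeasurableSpace Y] [BorelSpace Y]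
    (e : OpenPartialHomeomorph X Y) {s : Set X} (hs : MeasurableSet s) :
    MeasurableSet (e.symm ⁻¹' s ∩ e.target) := by
  have h1 : Measurable (e.target.domRestrict e.symm) :=
    (continuousOn_iff_continuous_domRestrict.1 e.symm.continuousOn).measurable
  have h2 := (e.open_target.measurableSet).subtype_image (h1 hs)
  convert h2 using 1
  ext y
  simp [Set.mem_image, and_comm]

theorem aemeasurable_symm_withDensity {X Y : Type*} [TopologicalSpace X] [TopologicalSpace Y]
    [MeasurableSpace X] [BorelSpace X] [MeasurableSpace Y] [BorelSpace Y]
    (e : OpenPartialHomeomorph X Y) (μ : Measure Y) (f : Y → ENNReal) :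
    AEMeasurable e.symm ((μ.restrict e.target).withDensity f) :=
  (e.symm.continuousOn.aemeasurable e.open_target.measurableSet).mono_ac
    (withDensity_absolutelyContinuous _ _)

variable {n : ℕ} {M : Type*} [TopologicalSpace M]
  [ChartedSpace (EuclideanSpace ℝ (Fin n)) M] [IsManifold (𝓡 n) ∞ M]
  {e e' : OpenPartialHomeomorph M (EuclideanSpace ℝ (Fin n))} (g : Metric n M)

theorem continuousOn_sqrt_det_gram (he : e ∈ charts n M) :
    ContinuousOn (fun y => Real.sqrt (gram g e y).det) e.target := fun _ hy =>
  ((contDiffAt_det (contDiffAt_gram g he hy)).continuousAt.sqrt).continuousWithinAt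

theorem aemeasurable_density (he : e ∈ charts n M) :
    AEMeasurable (fun y => ENNReal.ofReal (Real.sqrt (gram g e y).det))
      (MeasureTheory.volume.restrict e.target) :=
  ((continuousOn_sqrt_det_gram g he).aemeasurable e.open_target.measurableSet).ennreal_ofReal

variable [MeasurableSpace M] [BorelSpace M]

theorem chartVolume_apply {s : Set M} (hs : MeasurableSet s) :
    chartVolume g e s = ∫⁻ y in e.symm ⁻¹' s ∩ e.target,
      ENNReal.ofReal (Real.sqrt (gram g e y).det) := by
  rw [chartVolume, Measure.map_apply_of_aemeasurable (aemeasurable_symm_withDensity e _ _) hs,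
    withDensity_apply', Measure.restrict_restrict' e.open_target.measurableSet]

theorem chartVolume_compl_source : chartVolume g e e.sourceᶜ = 0 := by
  rw [chartVolume_apply g e.open_source.measurableSet.compl]
  have : e.symm ⁻¹' e.sourceᶜ ∩ e.target = ∅ := by
    ext y
    simp only [Set.mem_inter_iff, Set.mem_preimage, Set.mem_compl_iff, Set.mem_empty_iff_false,
      iff_false, not_and]
    exact fun h hy => h (e.map_target hy)
  rw [this]
  simp

/-- The change of variables formula: the volumes of two charts agree on the intersection of their
domains. -/
theorem chartVolume_eq_of_subset (he : e ∈ charts n M) (he' : e' ∈ charts n M) {s : Set M}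
    (hs : MeasurableSet s) (hse : s ⊆ e.source) (hse' : s ⊆ e'.source) :
    chartVolume g e s = chartVolume g e' s := by
  rw [chartVolume_apply g hs, chartVolume_apply g hs]
  have himage : e.symm ⁻¹' s ∩ e.target = (e ∘ e'.symm) '' (e'.symm ⁻¹' s ∩ e'.target) := by
    ext y
    constructor
    · rintro ⟨hy, hyt⟩
      refine ⟨e' (e.symm y), ⟨?_, e'.map_source (hse' hy)⟩, ?_⟩
      · simpa [e'.left_inv (hse' hy)] using hy
      · simp [e'.left_inv (hse' hy), e.right_inv hyt]
    · rintro ⟨z, ⟨hz, hzt⟩, rfl⟩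
      refine ⟨?_, e.map_source (hse hz)⟩
      simpa [e.left_inv (hse hz)] using hz
  have hinj : Set.InjOn (e ∘ e'.symm) (e'.symm ⁻¹' s ∩ e'.target) := by
    intro z hz w hw hzw
    exact e'.symm.injOn hz.2 hw.2 (e.injOn (hse hz.1) (hse hw.1) hzw)
  have hm := measurableSet_preimage_inter_target e' hs
  rw [himage, lintegral_image_eq_lintegral_abs_det_fderiv_mul _ hm
    (fun z hz => ((contDiffAt_transition he he' hz.2 (hse hz.1)).differentiableAt
      (by simp)).hasFDerivAt.hasFDerivWithinAt) hinj]
  refine setLIntegral_congr_fun hm fun z hz => ?_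
  rw [det_gram_eq_of_mem g he he' hz.2 (hse hz.1), Real.sqrt_mul (sq_nonneg _), Real.sqrt_sq_eq_abs,
    ENNReal.ofReal_mul (abs_nonneg _), det_fderiv_eq_det_jacobian]
  rfl

/-- The Riemannian volume restricts to `√(det g_ij) dy` on the domain of every chart. The measure
that equals `chartVolume g e` on the domain of `e` and is infinite on every nonempty set outside
dominates the volumes of all charts. -/
theorem volume_restrict_source (he : e ∈ charts n M) :
    (volume g).restrict e.source = chartVolume g e := by
  have hms : MeasurableSet e.source := e.open_source.measurableSet
  have hself : (chartVolume g e).restrict e.source = chartVolume g e :=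
    Measure.restrict_eq_self_of_ae_mem (by
      rw [ae_iff]; exact chartVolume_compl_source g)
  apply le_antisymm
  · have hle : volume g ≤ chartVolume g e + (⊤ : Measure M).restrict e.sourceᶜ := by
      refine iSup₂_le fun e' he' => Measure.le_iff.2 fun s hs => ?_
      rw [← measure_inter_add_sdiff s hms, Measure.add_apply, Measure.restrict_apply hs]
      refine add_le_add ?_ ((le_top : chartVolume g e' ≤ ⊤) _)
      calc chartVolume g e' (s ∩ e.source)
          ≤ chartVolume g e' (s ∩ e.source ∩ e'.source) + chartVolume g e' e'.sourceᶜ :=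
            (measure_mono fun p hp => by
              by_cases h : p ∈ e'.source
              · exact Or.inl ⟨hp, h⟩
              · exact Or.inr h).trans (measure_union_le _ _)
        _ = chartVolume g e (s ∩ e.source ∩ e'.source) := by
            rw [chartVolume_compl_source, add_zero]
            exact chartVolume_eq_of_subset g he' he
              ((hs.inter hms).inter e'.open_source.measurableSet) Set.inter_subset_right
              (Set.inter_subset_left.trans Set.inter_subset_right)
        _ ≤ chartVolume g e s :=
            measure_mono (Set.inter_subset_left.trans Set.inter_subset_left)
    have h2 := Measure.restrict_mono (le_refl e.source) hle
    rw [Measure.restrict_add, Measure.restrict_restrict hms, Set.inter_compl_self,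
      Measure.restrict_empty, add_zero, hself] at h2
    exact h2
  · rw [← hself]
    exact Measure.restrict_mono le_rfl (le_iSup₂_of_le e he le_rfl)

theorem volume_apply_of_subset (he : e ∈ charts n M) {s : Set M} (hs : s ⊆ e.source) :
    volume g s = chartVolume g e s := by
  rw [← volume_restrict_source g he, Measure.restrict_eq_self _ hs]

/-- The integral of a function that is supported in the domain of a chart. -/
theorem integral_volume_eq (he : e ∈ charts n M) {h : M → ℝ} (hc : ContinuousOn h e.source)
    (h0 : ∀ p ∉ e.source, h p = 0) :
    ∫ p, h p ∂(volume g) = ∫ y in e.target, Real.sqrt (gram g e y).det * h (e.symm y) := by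
  have hm : AEStronglyMeasurable h (chartVolume g e) := by
    rw [← volume_restrict_source g he]
    exact hc.aestronglyMeasurable e.open_source.measurableSet
  rw [← setIntegral_eq_integral_of_forall_compl_eq_zero h0, volume_restrict_source g he,
    chartVolume, integral_map (aemeasurable_symm_withDensity e _ _) hm,
    integral_withDensity_eq_integral_toReal_smul₀ (aemeasurable_density g he) (by simp)]
  refine integral_congr_ae (Filter.Eventually.of_forall fun y => ?_)
  simp [ENNReal.toReal_ofReal (Real.sqrt_nonneg _)]

theorem volume_lt_top_of_isCompact (he : e ∈ charts n M) {K : Set M} (hK : IsCompact K)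
    (hKm : MeasurableSet K) (hKe : K ⊆ e.source) : volume g K < ⊤ := by
  rw [volume_apply_of_subset g he hKe, chartVolume_apply g hKm]
  have himage : e.symm ⁻¹' K ∩ e.target = e '' K := by
    rw [Set.inter_comm, ← e.image_eq_target_inter_inv_preimage hKe]
  have hc : IsCompact (e '' K) := hK.image_of_continuousOn (e.continuousOn.mono hKe)
  have hsub : e '' K ⊆ e.target := by
    rw [← himage]; exact Set.inter_subset_right
  have hint : IntegrableOn (fun y => Real.sqrt (gram g e y).det) (e '' K) MeasureTheory.volume :=
    ((continuousOn_sqrt_det_gram g he).mono hsub).integrableOn_compact hc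
  rw [himage]
  exact Integrable.lintegral_lt_top hint

theorem isFiniteMeasure_volume [T2Space M] [CompactSpace M] : IsFiniteMeasure (volume g) := by
  have : IsLocallyFiniteMeasure (volume g) := by
    refine ⟨fun p => ?_⟩
    obtain ⟨K, hK, hpK, hKs⟩ := exists_compact_subset
      (chartAt (EuclideanSpace ℝ (Fin n)) p).open_source (mem_chart_source _ p)
    exact ⟨K, mem_interior_iff_mem_nhds.1 hpK, volume_lt_top_of_isCompact g
      (IsManifold.chart_mem_maximalAtlas p) hK hK.measurableSet hKs⟩
  exact CompactSpace.isFiniteMeasure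

theorem isOpenPosMeasure_volume : (volume g).IsOpenPosMeasure := by
  refine ⟨fun U hU ⟨p, hp⟩ h0 => ?_⟩
  set e := chartAt (EuclideanSpace ℝ (Fin n)) p with hedef
  have he : e ∈ charts n M := IsManifold.chart_mem_maximalAtlas p
  have hpe : p ∈ e.source := mem_chart_source _ p
  have hUo : IsOpen (U ∩ e.source) := hU.inter e.open_source
  have h1 : chartVolume g e (U ∩ e.source) = 0 := by
    rw [← volume_apply_of_subset g he Set.inter_subset_right]
    exact measure_mono_null Set.inter_subset_left h0
  rw [chartVolume_apply g hUo.measurableSet] at h1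
  set A := e.symm ⁻¹' (U ∩ e.source) ∩ e.target with hA
  have hAo : IsOpen A := by
    rw [hA, Set.inter_comm]
    exact e.symm.isOpen_inter_preimage hUo
  rw [lintegral_eq_zero_iff' ((aemeasurable_density g he).mono_measure
    (Measure.restrict_mono Set.inter_subset_right le_rfl)), Filter.EventuallyEq,
    ae_restrict_iff' hAo.measurableSet] at h1
  have h2 : MeasureTheory.volume A = 0 := by
    refine measure_mono_null ?_ (ae_iff.1 h1)
    intro y hy h3
    have h4 := h3 hy
    simp only [Pi.zero_apply, ENNReal.ofReal_eq_zero] at h4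
    exact absurd (Real.sqrt_pos.2 (det_gram_pos g he hy.2)) (not_lt.2 h4)
  have h3 : e p ∈ A := ⟨by simpa [e.left_inv hpe] using ⟨hp, hpe⟩, e.map_source hpe⟩
  exact (hAo.measure_pos MeasureTheory.volume ⟨_, h3⟩).ne' h2

end Volume

/-! ### Integration by parts -/

section IntegrationByParts

open MeasureTheory

variable {n : ℕ}

theorem integral_pderiv_eq_zero {b : EuclideanSpace ℝ (Fin n) → ℝ} (hb : ContDiff ℝ 1 b)
    (hc : HasCompactSupport b) (i : Fin n) : ∫ y, pderiv i b y = 0 := by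
  have hd : Continuous (fun y => fderiv ℝ b y (EuclideanSpace.single i 1)) :=
    (hb.continuous_fderiv (by simp)).clm_apply continuous_const
  have h := integral_mul_fderiv_eq_neg_fderiv_mul_of_integrable
    (μ := (MeasureTheory.volume : Measure (EuclideanSpace ℝ (Fin n))))
    (f := fun _ => (1 : ℝ)) (g := b) (v := EuclideanSpace.single i 1)
    (by simp) (by simpa using hd.integrable_of_hasCompactSupport (hc.fderiv_apply ℝ _))
    (by simpa using hb.continuous.integrable_of_hasCompactSupport hc)
    (fun _ _ => differentiableAt_const _) (fun y _ => hb.differentiable (by simp) y)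
  simp only [one_mul, fderiv_fun_const, Pi.zero_apply, zero_apply, zero_mul,
    integral_zero, neg_zero] at h
  exact h

/-- Integration by parts on an open set `T` for a function `a` that vanishes outside a compact
subset `K` of `T`. -/
theorem setIntegral_mul_sum_pderiv {T K : Set (EuclideanSpace ℝ (Fin n))} (hT : IsOpen T)
    (hK : IsCompact K) (hKT : K ⊆ T) {a : EuclideanSpace ℝ (Fin n) → ℝ}
    {X : Fin n → EuclideanSpace ℝ (Fin n) → ℝ} (ha : ∀ y ∈ T, ContDiffAt ℝ ∞ a y)
    (ha0 : ∀ y ∈ T \ K, a y = 0) (hX : ∀ i, ∀ y ∈ T, ContDiffAt ℝ ∞ (X i) y) :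
    ∫ y in T, a y * ∑ i, pderiv i (X i) y = -∫ y in T, ∑ i, pderiv i a y * X i y := by
  have hTK : IsOpen (T \ K) := hT.sdiff hK.isClosed
  have hda0 : ∀ i, ∀ y ∈ T \ K, pderiv i a y = 0 := by
    intro i y hy
    have hev : a =ᶠ[𝓝 y] fun _ => 0 := by
      filter_upwards [hTK.mem_nhds hy] with z hz using ha0 z hz
    rw [pderiv_congr hev, pderiv_const]
  have hint : ∀ c : EuclideanSpace ℝ (Fin n) → ℝ, ContinuousOn c T → (∀ y ∈ T \ K, c y = 0) →
      IntegrableOn c T := fun c hc hc0 =>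
    ((hc.mono hKT).integrableOn_compact hK).of_forall_sdiff_eq_zero hT.measurableSet hc0
  have hint1 : ∀ i, IntegrableOn (fun y => pderiv i a y * X i y) T := fun i =>
    hint _ (fun y hy => (((contDiffAt_pderiv (ha y hy) i).continuousAt).mul
      (hX i y hy).continuousAt).continuousWithinAt) fun y hy => by rw [hda0 i y hy, zero_mul]
  have hint2 : ∀ i, IntegrableOn (fun y => a y * pderiv i (X i) y) T := fun i =>
    hint _ (fun y hy => (((ha y hy).continuousAt).mul
      (contDiffAt_pderiv (hX i y hy) i).continuousAt).continuousWithinAt)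
      fun y hy => by rw [ha0 y hy, zero_mul]
  have hzero : ∀ i, ∫ y in T, (pderiv i a y * X i y + a y * pderiv i (X i) y) = 0 := by
    intro i
    set b := T.indicator (fun y => a y * X i y) with hb
    have hbT : ∀ y ∈ T, b =ᶠ[𝓝 y] fun y => a y * X i y := fun y hy => by
      filter_upwards [hT.mem_nhds hy] with z hz using Set.indicator_of_mem hz _
    have hbK : ∀ y ∉ K, b y = 0 := by
      intro y hy
      by_cases hyT : y ∈ T
      · rw [hb, Set.indicator_of_mem hyT, ha0 y ⟨hyT, hy⟩, zero_mul]
      · exact Set.indicator_of_notMem hyT _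
    have hbK' : ∀ y ∉ K, b =ᶠ[𝓝 y] fun _ => 0 := fun y hy => by
      filter_upwards [hK.isClosed.isOpen_compl.mem_nhds hy] with z hz using hbK z hz
    have hbs : ContDiff ℝ 1 b := contDiff_iff_contDiffAt.2 fun y => by
      by_cases hy : y ∈ T
      · exact (((ha y hy).mul (hX i y hy)).of_le (by simp)).congr_of_eventuallyEq (hbT y hy)
      · exact contDiffAt_const.congr_of_eventuallyEq (hbK' y fun h => hy (hKT h))
    have hbc : HasCompactSupport b := HasCompactSupport.intro hK hbK
    rw [← integral_pderiv_eq_zero hbs hbc i, ← setIntegral_eq_integral_of_forall_compl_eq_zero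
      (s := T) (f := pderiv i b) fun y hy => by
        rw [pderiv_congr (hbK' y fun h => hy (hKT h)), pderiv_const]]
    refine setIntegral_congr_fun hT.measurableSet fun y hy => ?_
    rw [pderiv_congr (hbT y hy), pderiv_mul (differentiableAt_of_smooth (ha y hy))
      (differentiableAt_of_smooth (hX i y hy))]
  simp only [Finset.mul_sum]
  rw [integral_finsetSum _ fun i _ => hint2 i, integral_finsetSum _ fun i _ => hint1 i,
    eq_neg_iff_add_eq_zero, ← Finset.sum_add_distrib]
  refine Finset.sum_eq_zero fun i _ => ?_
  have := hzero i
  rw [integral_add (hint1 i) (hint2 i)] at this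
  linarith

variable {M : Type*} [TopologicalSpace M]
  [ChartedSpace (EuclideanSpace ℝ (Fin n)) M] [IsManifold (𝓡 n) ∞ M]
  {e e' : OpenPartialHomeomorph M (EuclideanSpace ℝ (Fin n))} (g : Metric n M)

/-- The function `∇a · ∇b` on `M`, computed at each point in the preferred chart. -/
def gradProduct (a b : M → ℝ) (p : M) : ℝ :=
  gradInner (gram g (chartAt (EuclideanSpace ℝ (Fin n)) p))
    (a ∘ (chartAt (EuclideanSpace ℝ (Fin n)) p).symm)
    (b ∘ (chartAt (EuclideanSpace ℝ (Fin n)) p).symm) (chartAt (EuclideanSpace ℝ (Fin n)) p p)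

variable {φ u η a b : M → ℝ}

theorem gradProduct_eq (ha : ContMDiff (𝓡 n) 𝓘(ℝ, ℝ) ∞ a) (hb : ContMDiff (𝓡 n) 𝓘(ℝ, ℝ) ∞ b)
    (he : e ∈ charts n M) {p : M} (hp : p ∈ e.source) :
    gradProduct g a b p = gradInner (gram g e) (a ∘ e.symm) (b ∘ e.symm) (e p) :=
  gradInner_eq_of_mem g he (IsManifold.chart_mem_maximalAtlas p) ha hb hp (mem_chart_source _ p)

theorem continuous_gradProduct (ha : ContMDiff (𝓡 n) 𝓘(ℝ, ℝ) ∞ a)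
    (hb : ContMDiff (𝓡 n) 𝓘(ℝ, ℝ) ∞ b) : Continuous (gradProduct g a b) := by
  refine continuous_iff_continuousAt.2 fun p => ?_
  set e := chartAt (EuclideanSpace ℝ (Fin n)) p with hedef
  have he : e ∈ charts n M := IsManifold.chart_mem_maximalAtlas p
  have hp : p ∈ e.source := mem_chart_source _ p
  have hy := e.map_source hp
  have h1 : ContinuousAt (gradInner (gram g e) (a ∘ e.symm) (b ∘ e.symm)) (e p) :=
    (contDiffAt_gradInner (contDiffAt_gram g he hy) (det_gram_pos g he hy).ne'
      (contDiffAt_comp_symm he hy ha.contMDiffAt)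
      (contDiffAt_comp_symm he hy hb.contMDiffAt)).continuousAt
  refine (h1.comp (e.continuousAt hp)).congr ?_
  filter_upwards [e.open_source.mem_nhds hp] with q hq using (gradProduct_eq g ha hb he hq).symm

theorem gradProduct_eq_zero_of_notMem {p : M} (hp : p ∉ tsupport a) : gradProduct g a b p = 0 := by
  set e := chartAt (EuclideanSpace ℝ (Fin n)) p with hedef
  have hpe : p ∈ e.source := mem_chart_source _ p
  have hev : a ∘ e.symm =ᶠ[𝓝 (e p)] fun _ => 0 := by
    have h1 : e.symm ⁻¹' (tsupport a)ᶜ ∈ 𝓝 (e p) :=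
      (e.symm.continuousAt (e.map_source hpe)).preimage_mem_nhds
        ((isClosed_tsupport a).isOpen_compl.mem_nhds (by simpa [e.left_inv hpe] using hp))
    filter_upwards [h1] with z hz
    exact image_eq_zero_of_notMem_tsupport (f := a) hz
  have : ∀ i, pderiv i (a ∘ e.symm) (e p) = 0 := fun i => by
    rw [pderiv_congr hev, pderiv_const]
  rw [gradProduct, ← hedef]
  simp [gradInner, this]

theorem contDiffAt_bakryEmery_gram (hφ : ContMDiff (𝓡 n) 𝓘(ℝ, ℝ) ∞ φ)
    (hu : ContMDiff (𝓡 n) 𝓘(ℝ, ℝ) ∞ u) (he : e ∈ charts n M) {y : EuclideanSpace ℝ (Fin n)}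
    (hy : y ∈ e.target) :
    ContDiffAt ℝ ∞ (bakryEmeryLaplacian (gram g e) (φ ∘ e.symm) (u ∘ e.symm)) y :=
  contDiffAt_bakryEmeryLaplacian (contDiffAt_gram g he hy) (det_gram_pos g he hy).ne'
    (contDiffAt_comp_symm he hy hφ.contMDiffAt) (contDiffAt_comp_symm he hy hu.contMDiffAt)

theorem continuousOn_bakryEmery (hφ : ContMDiff (𝓡 n) 𝓘(ℝ, ℝ) ∞ φ)
    (hu : ContMDiff (𝓡 n) 𝓘(ℝ, ℝ) ∞ u) (he : e ∈ charts n M) :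
    ContinuousOn (fun p => bakryEmeryLaplacian (gram g e) (φ ∘ e.symm) (u ∘ e.symm) (e p))
      e.source := fun _ hp =>
  ((contDiffAt_bakryEmery_gram g hφ hu he (e.map_source hp)).continuousAt.comp
    (e.continuousAt hp)).continuousWithinAt

variable [MeasurableSpace M] [BorelSpace M]

/-- The weak form of the Bakry-Émery Laplacian in a chart, tested against functions supported in
the domain of the chart. -/
theorem integral_mul_bakryEmery [CompactSpace M] (hφ : ContMDiff (𝓡 n) 𝓘(ℝ, ℝ) ∞ φ)
    (hu : ContMDiff (𝓡 n) 𝓘(ℝ, ℝ) ∞ u) (hη : ContMDiff (𝓡 n) 𝓘(ℝ, ℝ) ∞ η)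
    (he : e ∈ charts n M) (hsupp : tsupport η ⊆ e.source) :
    ∫ p, η p * (bakryEmeryLaplacian (gram g e) (φ ∘ e.symm) (u ∘ e.symm) (e p)
        * Real.exp (-φ p)) ∂(volume g)
      = -∫ p, gradProduct g η u p * Real.exp (-φ p) ∂(volume g) := by
  have hexp : Continuous fun p => Real.exp (-φ p) := Real.continuous_exp.comp hφ.continuous.neg
  rw [integral_volume_eq g he
      (hη.continuous.continuousOn.fun_mul
        ((continuousOn_bakryEmery g hφ hu he).fun_mul hexp.continuousOn))
      (fun p hp => by rw [image_eq_zero_of_notMem_tsupport fun h => hp (hsupp h), zero_mul]),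
    integral_volume_eq g he (((continuous_gradProduct g hη hu).fun_mul hexp).continuousOn)
      (fun p hp => by
        rw [gradProduct_eq_zero_of_notMem g fun h => hp (hsupp h), zero_mul])]
  have hsm : ∀ {c : M → ℝ}, ContMDiff (𝓡 n) 𝓘(ℝ, ℝ) ∞ c → ∀ y ∈ e.target,
      ContDiffAt ℝ ∞ (c ∘ e.symm) y := fun hc y hy => contDiffAt_comp_symm he hy hc.contMDiffAt
  have hKc : IsCompact (e '' tsupport η) :=
    (isClosed_tsupport η).isCompact.image_of_continuousOn (e.continuousOn.mono hsupp)
  have hKT : e '' tsupport η ⊆ e.target := by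
    rintro _ ⟨p, hp, rfl⟩
    exact e.map_source (hsupp hp)
  have key := setIntegral_mul_sum_pderiv e.open_target hKc hKT (a := η ∘ e.symm)
    (X := flux (gram g e) (φ ∘ e.symm) (u ∘ e.symm)) (hsm hη)
    (fun y hy => image_eq_zero_of_notMem_tsupport (f := η) fun h =>
      hy.2 ⟨e.symm y, h, e.right_inv hy.1⟩)
    (fun i y hy => contDiffAt_flux (contDiffAt_gram g he hy) (det_gram_pos g he hy)
      (hsm hφ y hy) (hsm hu y hy) i)
  have h1 : ∀ y ∈ e.target, Real.sqrt (gram g e y).det * (η (e.symm y) *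
      (bakryEmeryLaplacian (gram g e) (φ ∘ e.symm) (u ∘ e.symm) (e (e.symm y))
        * Real.exp (-φ (e.symm y))))
      = (η ∘ e.symm) y * ∑ i, pderiv i (flux (gram g e) (φ ∘ e.symm) (u ∘ e.symm) i) y := by
    intro y hy
    rw [sum_pderiv_flux (contDiffAt_gram g he hy) (eventually_gram_symm g y)
      (det_gram_pos g he hy) (hsm hφ y hy) (hsm hu y hy), e.right_inv hy, weight]
    simp only [Function.comp_apply]
    ring
  have h2 : ∀ y ∈ e.target, Real.sqrt (gram g e y).det *
      (gradProduct g η u (e.symm y) * Real.exp (-φ (e.symm y)))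
      = ∑ i, pderiv i (η ∘ e.symm) y * flux (gram g e) (φ ∘ e.symm) (u ∘ e.symm) i y := by
    intro y hy
    rw [sum_pderiv_mul_flux, gradProduct_eq g hη hu he (e.map_target hy), e.right_inv hy, weight]
    simp only [Function.comp_apply]
    ring
  rw [setIntegral_congr_fun e.open_target.measurableSet h1,
    setIntegral_congr_fun e.open_target.measurableSet h2, key]

/-- The Bakry-Émery Laplacian does not depend on the chart: in the weak form it is determined by
the volume and by the gradient product, which do not depend on the chart. -/
theorem bakryEmery_eq_of_mem [CompactSpace M] [T2Space M] (hφ : ContMDiff (𝓡 n) 𝓘(ℝ, ℝ) ∞ φ)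
    (hu : ContMDiff (𝓡 n) 𝓘(ℝ, ℝ) ∞ u) (he : e ∈ charts n M) (he' : e' ∈ charts n M)
    {p : M} (hp : p ∈ e.source) (hp' : p ∈ e'.source) :
    bakryEmeryLaplacian (gram g e) (φ ∘ e.symm) (u ∘ e.symm) (e p)
      = bakryEmeryLaplacian (gram g e') (φ ∘ e'.symm) (u ∘ e'.symm) (e' p) := by
  have := isFiniteMeasure_volume g
  have := isOpenPosMeasure_volume g
  set U := e.source ∩ e'.source with hU
  have hUo : IsOpen U := e.open_source.inter e'.open_source
  set B := fun p => bakryEmeryLaplacian (gram g e) (φ ∘ e.symm) (u ∘ e.symm) (e p)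
    * Real.exp (-φ p) with hB
  set B' := fun p => bakryEmeryLaplacian (gram g e') (φ ∘ e'.symm) (u ∘ e'.symm) (e' p)
    * Real.exp (-φ p) with hB'
  have hexp : Continuous fun p => Real.exp (-φ p) := Real.continuous_exp.comp hφ.continuous.neg
  have hBe : ContinuousOn B e.source :=
    (continuousOn_bakryEmery g hφ hu he).mul hexp.continuousOn
  have hBe' : ContinuousOn B' e'.source :=
    (continuousOn_bakryEmery g hφ hu he').mul hexp.continuousOn
  have hBc : ContinuousOn B U := hBe.mono Set.inter_subset_left
  have hBc' : ContinuousOn B' U := hBe'.mono Set.inter_subset_right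
  have hint : ∀ η : M → ℝ, ContMDiff (𝓡 n) 𝓘(ℝ, ℝ) ∞ η → tsupport η ⊆ U →
      ∫ x, η x • (B x - B' x) ∂(volume g) = 0 := by
    intro η hη hηU
    have hi : ∀ {C : M → ℝ}, ContinuousOn C U → Integrable (fun x => η x * C x) (volume g) := by
      intro C hC
      have h1 : IntegrableOn (fun x => η x * C x) (tsupport η) (volume g) :=
        ((hη.continuous.continuousOn).mul (hC.mono hηU)).integrableOn_compact
          (isClosed_tsupport η).isCompact
      rw [← integrableOn_univ]
      refine h1.of_forall_sdiff_eq_zero MeasurableSet.univ fun x hx => ?_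
      rw [image_eq_zero_of_notMem_tsupport hx.2, zero_mul]
    simp only [smul_eq_mul, mul_sub]
    rw [integral_sub (hi hBc) (hi hBc'),
      integral_mul_bakryEmery g hφ hu hη he (hηU.trans Set.inter_subset_left),
      integral_mul_bakryEmery g hφ hu hη he' (hηU.trans Set.inter_subset_right), sub_self]
  have hae := hUo.ae_eq_zero_of_integral_contMDiff_smul_eq_zero (𝓡 n) (μ := volume g)
    (f := fun x => B x - B' x) ((hBc.sub hBc').locallyIntegrableOn hUo.measurableSet)
    (fun η hη _ hηU => hint η hη hηU)
  have heq : Set.EqOn (fun x => B x - B' x) (fun _ => 0) U :=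
    Measure.eqOn_open_of_ae_eq (μ := volume g) ((ae_restrict_iff' hUo.measurableSet).2 hae) hUo
      (hBc.sub hBc') continuousOn_const
  have h1 := heq ⟨hp, hp'⟩
  simp only [hB, hB', ← sub_mul] at h1
  exact sub_eq_zero.1 ((mul_eq_zero.1 h1).resolve_right (Real.exp_ne_zero _))

end IntegrationByParts

/-! ### Gradient solitons -/

section Soliton

open MeasureTheory

variable {n : ℕ} {M : Type*} [TopologicalSpace M] [T2Space M] [CompactSpace M]
  [ChartedSpace (EuclideanSpace ℝ (Fin n)) M] [IsManifold (𝓡 n) ∞ M]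
  [MeasurableSpace M] [BorelSpace M]
  {e : OpenPartialHomeomorph M (EuclideanSpace ℝ (Fin n))} (g : Metric n M) {φ u f : M → ℝ}

/-- The Bakry-Émery Laplacian `Δ_φ u` as a function on `M`, computed at each point in the
preferred chart. -/
def bakryEmery {n : ℕ} {M : Type*} [TopologicalSpace M]
    [ChartedSpace (EuclideanSpace ℝ (Fin n)) M] [IsManifold (𝓡 n) ∞ M] (g : Metric n M)
    (φ u : M → ℝ) (p : M) : ℝ :=
  bakryEmeryLaplacian (gram g (chartAt (EuclideanSpace ℝ (Fin n)) p))
    (φ ∘ (chartAt (EuclideanSpace ℝ (Fin n)) p).symm)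
    (u ∘ (chartAt (EuclideanSpace ℝ (Fin n)) p).symm) (chartAt (EuclideanSpace ℝ (Fin n)) p p)

theorem bakryEmery_eq (hφ : ContMDiff (𝓡 n) 𝓘(ℝ, ℝ) ∞ φ) (hu : ContMDiff (𝓡 n) 𝓘(ℝ, ℝ) ∞ u)
    (he : e ∈ charts n M) {p : M} (hp : p ∈ e.source) :
    bakryEmery g φ u p
      = bakryEmeryLaplacian (gram g e) (φ ∘ e.symm) (u ∘ e.symm) (e p) :=
  bakryEmery_eq_of_mem g hφ hu (IsManifold.chart_mem_maximalAtlas p) he (mem_chart_source _ p) hp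

theorem continuous_bakryEmery (hφ : ContMDiff (𝓡 n) 𝓘(ℝ, ℝ) ∞ φ)
    (hu : ContMDiff (𝓡 n) 𝓘(ℝ, ℝ) ∞ u) : Continuous (bakryEmery g φ u) := by
  refine continuous_iff_continuousAt.2 fun p => ?_
  have he := IsManifold.chart_mem_maximalAtlas (I := 𝓡 n) (n := ∞) p
  have hp := mem_chart_source (EuclideanSpace ℝ (Fin n)) p
  have ho := (chartAt (EuclideanSpace ℝ (Fin n)) p).open_source.mem_nhds hp
  refine ((continuousOn_bakryEmery g hφ hu he).continuousAt ho).congr ?_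
  filter_upwards [ho] with q hq using (bakryEmery_eq g hφ hu he hq).symm

/-- `Δ_φ u` has zero mean for the measure `e^{-φ} dV_g`. -/
theorem integral_bakryEmery_eq_zero (hφ : ContMDiff (𝓡 n) 𝓘(ℝ, ℝ) ∞ φ)
    (hu : ContMDiff (𝓡 n) 𝓘(ℝ, ℝ) ∞ u) :
    ∫ p, bakryEmery g φ u p * Real.exp (-φ p) ∂(volume g) = 0 := by
  have := isFiniteMeasure_volume g
  have hint : ∀ {h : M → ℝ}, Continuous h → Integrable h (volume g) := fun hh =>
    hh.integrable_of_hasCompactSupport (HasCompactSupport.of_compactSpace _)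
  have hexp : Continuous fun p => Real.exp (-φ p) := Real.continuous_exp.comp hφ.continuous.neg
  obtain ⟨t, ht⟩ := isCompact_univ.elim_nhds_subcover
    (fun p : M => (chartAt (EuclideanSpace ℝ (Fin n)) p).source)
    (fun p _ => (chartAt (EuclideanSpace ℝ (Fin n)) p).open_source.mem_nhds (mem_chart_source _ p))
  obtain ⟨ρ, hρ⟩ := SmoothPartitionOfUnity.exists_isSubordinate (𝓡 n) (s := (Set.univ : Set M))
    isClosed_univ (fun p : t => (chartAt (EuclideanSpace ℝ (Fin n)) (p : M)).source)
    (fun p => (chartAt (EuclideanSpace ℝ (Fin n)) (p : M)).open_source)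
    (fun q hq => by simpa using ht.2 hq)
  have hρs : ∀ i, ContMDiff (𝓡 n) 𝓘(ℝ, ℝ) ∞ (ρ i) := fun i => (ρ i).contMDiff
  have hρ1 : ∀ p, ∑ i, ρ i p = 1 := fun p => by
    rw [← finsum_eq_sum_of_fintype]; exact ρ.sum_eq_one (Set.mem_univ p)
  have h1 : ∀ i, ∫ p, ρ i p * (bakryEmery g φ u p * Real.exp (-φ p)) ∂(volume g)
      = -∫ p, gradProduct g (ρ i) u p * Real.exp (-φ p) ∂(volume g) := by
    intro i
    have he := IsManifold.chart_mem_maximalAtlas (I := 𝓡 n) (n := ∞) (i : M)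
    rw [← integral_mul_bakryEmery g hφ hu (hρs i) he (hρ i)]
    refine integral_congr_ae (Filter.Eventually.of_forall fun p => ?_)
    by_cases hp : p ∈ (chartAt (EuclideanSpace ℝ (Fin n)) (i : M)).source
    · simp only [bakryEmery_eq g hφ hu he hp]
    · simp only [image_eq_zero_of_notMem_tsupport fun h => hp (hρ i h), zero_mul]
  have h2 : ∀ p, ∑ i, gradProduct g (ρ i) u p = 0 := by
    intro p
    set e := chartAt (EuclideanSpace ℝ (Fin n)) p with hedef
    have he : e ∈ charts n M := IsManifold.chart_mem_maximalAtlas p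
    have hy : e p ∈ e.target := e.map_source (mem_chart_source _ p)
    have h3 : ∀ k, ∑ i, pderiv k (ρ i ∘ e.symm) (e p) = 0 := by
      intro k
      rw [← pderiv_sum Finset.univ (F := fun i => ρ i ∘ e.symm) fun i _ =>
        differentiableAt_of_smooth (contDiffAt_comp_symm he hy (hρs i).contMDiffAt)]
      simp only [Function.comp_apply, hρ1, pderiv_const]
    simp only [gradProduct, ← hedef, gradInner]
    rw [Finset.sum_comm]
    refine Finset.sum_eq_zero fun k _ => ?_
    rw [Finset.sum_comm]
    refine Finset.sum_eq_zero fun l _ => ?_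
    rw [← Finset.sum_mul, ← Finset.mul_sum, h3, mul_zero, zero_mul]
  calc ∫ p, bakryEmery g φ u p * Real.exp (-φ p) ∂(volume g)
      = ∫ p, ∑ i, ρ i p * (bakryEmery g φ u p * Real.exp (-φ p)) ∂(volume g) := by
        simp only [← Finset.sum_mul, hρ1, one_mul]
    _ = ∑ i, ∫ p, ρ i p * (bakryEmery g φ u p * Real.exp (-φ p)) ∂(volume g) :=
        integral_finsetSum _ fun i _ => hint ((hρs i).continuous.fun_mul
          ((continuous_bakryEmery g hφ hu).fun_mul hexp))
    _ = -∫ p, ∑ i, gradProduct g (ρ i) u p * Real.exp (-φ p) ∂(volume g) := by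
        rw [integral_finsetSum _ fun i _ => hint
          ((continuous_gradProduct g (hρs i) hu).fun_mul hexp), ← Finset.sum_neg_distrib]
        exact Finset.sum_congr rfl fun i _ => h1 i
    _ = 0 := by simp only [← Finset.sum_mul, h2, zero_mul, integral_zero, neg_zero]

/-- For a gradient soliton the function `Δ_f f + 2 γ f` is locally constant. -/
theorem isLocallyConstant_bakryEmery_add (hf : ContMDiff (𝓡 n) 𝓘(ℝ, ℝ) ∞ f) {γ : ℝ}
    (hsol : IsGradientSoliton g f γ) :
    IsLocallyConstant fun p => bakryEmery g f f p + 2 * γ * f p := by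
  set Q := fun p => bakryEmery g f f p + 2 * γ * f p with hQ
  have hQe : ∀ e ∈ charts n M, ∀ y ∈ e.target, Q ∘ e.symm =ᶠ[𝓝 y] fun z =>
      bakryEmeryLaplacian (gram g e) (f ∘ e.symm) (f ∘ e.symm) z
        + 2 * γ * (f ∘ e.symm) z := by
    intro e he y hy
    filter_upwards [e.open_target.mem_nhds hy] with z hz
    simp only [hQ, Function.comp_apply, bakryEmery_eq g hf hf he (e.map_target hz), e.right_inv hz]
  have hQd : ∀ e ∈ charts n M, ∀ y ∈ e.target, DifferentiableAt ℝ (Q ∘ e.symm) y := by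
    intro e he y hy
    refine DifferentiableAt.congr_of_eventuallyEq ?_ (hQe e he y hy)
    exact (differentiableAt_of_smooth (contDiffAt_bakryEmery_gram g hf hf he hy)).add
      ((differentiableAt_of_smooth (contDiffAt_comp_symm he hy hf.contMDiffAt)).const_mul _)
  have hfd : ∀ e ∈ charts n M, ∀ y ∈ e.target, fderiv ℝ (Q ∘ e.symm) y = 0 := by
    intro e he y hy
    obtain ⟨e', he', h0, hp, hN⟩ := exists_normal_chart g (e.symm y)
    have hsol' : ∀ᶠ z in 𝓝 (0 : EuclideanSpace ℝ (Fin n)), ∀ i j,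
        ricci (gram g e') i j z - γ * gram g e' z i j
          + hessian (gram g e') (f ∘ e'.symm) i j z = 0 := by
      filter_upwards [e'.open_target.mem_nhds h0] with z hz using hsol e' he' z hz
    have hd0 : fderiv ℝ (Q ∘ e'.symm) 0 = 0 := by
      ext v
      rw [fderiv_apply_eq_sum_pderiv]
      refine Finset.sum_eq_zero fun m _ => ?_
      rw [pderiv_congr (hQe e' he' 0 h0), hN.pderiv_bakryEmeryLaplacian_add
        (contDiffAt_comp_symm he' h0 hf.contMDiffAt) hsol', mul_zero]
    have hys : e.symm y ∈ e'.source := hp ▸ e'.map_target h0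
    have hτ0 : (e' ∘ e.symm) y = 0 := by rw [Function.comp_apply, ← hp, e'.right_inv h0]
    have hτ : DifferentiableAt ℝ (e' ∘ e.symm) y :=
      (contDiffAt_transition he' he hy hys).differentiableAt (by simp)
    have hev : Q ∘ e.symm =ᶠ[𝓝 y] (Q ∘ e'.symm) ∘ (e' ∘ e.symm) :=
      (symm_eventuallyEq_comp_transition hy hys).fun_comp Q
    rw [hev.fderiv_eq, fderiv_comp y (by rw [hτ0]; exact hQd e' he' 0 h0) hτ, hτ0, hd0,
      ContinuousLinearMap.zero_comp]
  rw [IsLocallyConstant.iff_eventually_eq]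
  intro p
  set e := chartAt (EuclideanSpace ℝ (Fin n)) p with hedef
  have he : e ∈ charts n M := IsManifold.chart_mem_maximalAtlas p
  have hp : p ∈ e.source := mem_chart_source _ p
  have hopen := e.open_target.isOpen_inter_preimage_of_fderiv_eq_zero (f := Q ∘ e.symm)
    (fun y hy => (hQd e he y hy).differentiableWithinAt) (fun y hy => hfd e he y hy) {Q p}
  have hmem : e p ∈ e.target ∩ (Q ∘ e.symm) ⁻¹' {Q p} :=
    ⟨e.map_source hp, by simp [e.left_inv hp]⟩
  filter_upwards [(e.continuousAt hp).preimage_mem_nhds (hopen.mem_nhds hmem),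
    e.open_source.mem_nhds hp] with q hq hqs
  simpa [e.left_inv hqs] using hq.2

end Soliton

end Riem

end

theorem lemma2p1 {n : ℕ} {M : Type*} [TopologicalSpace M] [T2Space M] [CompactSpace M]
    [ConnectedSpace M] [ChartedSpace (EuclideanSpace ℝ (Fin n)) M] [IsManifold (𝓡 n) ∞ M]
    [MeasurableSpace M] [BorelSpace M]
    (g : Riem.Metric n M) (f : M → ℝ) (hf : ContMDiff (𝓡 n) 𝓘(ℝ, ℝ) ∞ f)
    (γ : ℝ) (hγ : 0 < γ) (hsol : Riem.IsGradientSoliton g f γ)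
    (hnorm : ∫ p, f p * Real.exp (-f p) ∂(Riem.volume g) = 0) :
    Riem.BakryEmeryEigenEq g f f (-2 * γ) ∧
      ((∃ p, mfderiv (𝓡 n) 𝓘(ℝ, ℝ) f p ≠ 0) → ∃ p, f p ≠ 0) := by
  refine ⟨fun e he p hp => ?_, ?_⟩
  · have := Riem.isFiniteMeasure_volume g
    have := Riem.isOpenPosMeasure_volume g
    have hint : ∀ {h : M → ℝ}, Continuous h → MeasureTheory.Integrable h (Riem.volume g) :=
      fun hh => hh.integrable_of_hasCompactSupport (HasCompactSupport.of_compactSpace _)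
    have hexp : Continuous fun p => Real.exp (-f p) := Real.continuous_exp.comp hf.continuous.neg
    set C := Riem.bakryEmery g f f p + 2 * γ * f p with hC
    have hconst : ∀ q, Riem.bakryEmery g f f q + 2 * γ * f q = C := fun q =>
      (Riem.isLocallyConstant_bakryEmery_add g hf hsol).apply_eq_of_preconnectedSpace q p
    have hpos : 0 < ∫ q, Real.exp (-f q) ∂(Riem.volume g) :=
      hexp.integral_pos_of_hasCompactSupport_nonneg_nonzero
        (HasCompactSupport.of_compactSpace _) (fun q => (Real.exp_pos _).le)
        (Real.exp_ne_zero (-f p))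
    have h1 : C * ∫ q, Real.exp (-f q) ∂(Riem.volume g) = 0 := by
      calc C * ∫ q, Real.exp (-f q) ∂(Riem.volume g)
          = ∫ q, (Riem.bakryEmery g f f q * Real.exp (-f q)
              + 2 * γ * (f q * Real.exp (-f q))) ∂(Riem.volume g) := by
            rw [← MeasureTheory.integral_const_mul]
            refine MeasureTheory.integral_congr_ae (Filter.Eventually.of_forall fun q => ?_)
            simp only [← hconst q]
            ring
        _ = 0 := by
            rw [MeasureTheory.integral_add (hint ((Riem.continuous_bakryEmery g hf hf).fun_mul hexp))
              ((hint (hf.continuous.fun_mul hexp)).const_mul _), MeasureTheory.integral_const_mul,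
              hnorm, Riem.integral_bakryEmery_eq_zero g hf hf, mul_zero, add_zero]
    have h2 : C = 0 := (mul_eq_zero.1 h1).resolve_right hpos.ne'
    rw [← Riem.bakryEmery_eq g hf hf he hp]
    linarith
  · rintro ⟨p, hp⟩
    by_contra! h
    apply hp
    rw [show f = fun _ => (0 : ℝ) from funext h, mfderiv_const]
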